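/- A binary $[n,k,d]_2$-code is a $k$-dimensional linear subspace of $\mathbb{F}_2^n$ with minimum Hamming distance at least $d$, and two binary codes are isomorphic if one arises from the other by a permutation of the coordinates. Up to isomorphism there are exactly two $[153,7,76]_2$-codes in which every codeword has Hamming weight at most $102$. One of them has $107$ codewords of weight $76$, $15$ of weight $80$ and $5$ of weight $92$; the other has $108$ codewords of weight $76$, $14$ of weight $80$, $4$ of weight $92$ and one of weight $96$; neither has any further nonzero codeword. Moreover, both codes come from additive $\mathbb{F}_4$-codes of length $51$ and minimum distance $38$: for each of them there is an additive subgroup $A\subseteq\mathbb{F}_4^{51}$ with $2^7$ elements and minimum Hamming distance $38$, all of whose coordinate projections $A\to\mathbb{F}_4$ are surjective, such that the binary code is isomorphic to the code of length $3\cdot 51=153$ obtained from $A$ by replacing each entry $x\in\mathbb{F}_4$ with $(f_1(x),f_2(x),f_3(x))$, where $f_1,f_2,f_3$ are the three nonzero $\mathbb{F}_2$-linear maps $\mathbb{F}_4\to\mathbb{F}_2$. -/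

import Mathlib

noncomputable section

namespace CodeClassification

/-- A binary linear code with coordinates indexed by `ι`. -/
abbrev BinaryCode (ι : Type*) := Submodule (ZMod 2) (ι → ZMod 2)

section Codes

variable {ι κ : Type*} [Fintype ι] [Fintype κ]

/-- `C` is an `[n,k,d]₂`-code: length `n`, dimension `k`, and minimum Hamming distance
at least `d`. -/
def IsLinearCode (C : BinaryCode ι) (n k d : ℕ) : Prop :=
  Fintype.card ι = n ∧ Module.finrank (ZMod 2) C = k ∧
    ∀ c ∈ C, ∀ c' ∈ C, c ≠ c' → d ≤ hammingDist c c'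

/-- Isomorphism of binary linear codes: equality up to a bijection of the coordinates
(nonzero scalars are trivial over `𝔽₂`). -/
def Isomorphic (C : BinaryCode ι) (D : BinaryCode κ) : Prop :=
  ∃ σ : ι ≃ κ, C.map (LinearEquiv.funCongrLeft (ZMod 2) (ZMod 2) σ.symm).toLinearMap = D

/-- The number of nonzero codewords of weight `w`. -/
def weightCount (C : BinaryCode ι) (w : ℕ) : ℕ :=
  Set.ncard {c : ι → ZMod 2 | c ∈ C ∧ c ≠ 0 ∧ hammingNorm c = w}

end Codes

/-- The field with four elements. -/
abbrev F4 := GaloisField 2 2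

/-- An additive code over `𝔽₄` of length `n`. -/
abbrev AdditiveF4Code (n : ℕ) := AddSubgroup (Fin n → F4)

/-- The three nonzero `𝔽₂`-linear functionals on `𝔽₄`; they are the three points of the line
that a coordinate of an additive `𝔽₄`-code stands for. -/
abbrev NonzeroFunctional := {f : F4 →ₗ[ZMod 2] ZMod 2 // f ≠ 0}

/-- Replace each coordinate in `𝔽₄` by its values under the three nonzero functionals. -/
def expand (n : ℕ) :
    (Fin n → F4) →ₗ[ZMod 2] (Fin n × NonzeroFunctional → ZMod 2) :=
  LinearMap.pi fun p => p.2.1.comp (LinearMap.proj p.1)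

/-- The binary code of length `3n` of an additive `𝔽₄`-code of length `n`: every line is replaced
by its three points. -/
def AdditiveF4Code.binaryCode {n : ℕ} (A : AdditiveF4Code n) :
    BinaryCode (Fin n × NonzeroFunctional) :=
  (AddSubgroup.toZModSubmodule 2 A).map (expand n)

open scoped Classical in
/-- `A` has minimum Hamming distance (exactly) `d`. -/
def AdditiveF4Code.HasMinDist {n : ℕ} (A : AdditiveF4Code n) (d : ℕ) : Prop :=
  IsLeast {m : ℕ | ∃ a ∈ A, ∃ b ∈ A, a ≠ b ∧ hammingDist a b = m} d

/-- Every coordinate of `A` takes all values in `𝔽₄`, that is, geometrically every coordinate is a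
line and not a point or the empty space. -/
def AdditiveF4Code.HasLineCoordinates {n : ℕ} (A : AdditiveF4Code n) : Prop :=
  ∀ i : Fin n, ∀ x : F4, ∃ a ∈ A, a i = x

/-- `C` comes from an additive `𝔽₄`-code of length `n` with minimum distance `d`,
with the same number of codewords. -/
def ComesFromAdditive {ι : Type*} (C : BinaryCode ι) (n d : ℕ) : Prop :=
  ∃ A : AdditiveF4Code n, Nat.card A = Nat.card C ∧ A.HasLineCoordinates ∧ A.HasMinDist d ∧
    Isomorphic C A.binaryCode

/-- The codes that are classified: `[153,7,76]₂`-codes without codewords of weight above `102`. -/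
def IsAdmissible (C : BinaryCode (Fin 153)) : Prop :=
  IsLinearCode C 153 7 76 ∧ ∀ c ∈ C, hammingNorm c ≤ 102

end CodeClassification

end

/-! A code is studied through its column multiplicities `f` on 𝔽₂⁷. Its weights are then Walsh
coefficients in disguise: W(p) = n − 2 wt(p). The parameters meet the Griesmer bound with n = 2d +
1. This forces the words of minimum weight to span: otherwise an averaging argument finds a column
whose deletion would violate the bound (`span_min_weight_eq_top`). The residual code of a word of
weight 76 also meets the bound, so residuals are even and the code is doubly even (`four_dvd_wt`).

Hence x(p) = (wt(p) − 76)/4, with x(0) = 0, is a multiset of points in the message space. Walsh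
inversion gives it 35 points and weight 8 + 8 f(q) at each q ≠ 0, so it is triply even and spanning;
the weight bound 102 becomes x ≤ 6. A word of weight 24 of x leaves a doubly even multiset of 11
points in its hyperplane, which contains exactly one point of multiplicity at least 4. Multiplying
characters over these heavy points yields an odd set T of heavy points with sum zero
(`exists_odd_set`). Subtracting 4T keeps the weights divisible by 8, and the possible sizes of T
leave only |T| = 5, the remainder being the 15 nonzero vectors of a 4-dimensional subspace D
(`exists_decomposition`).

Since D and T span, D meets the span of T in a single nonzero vector, which is either an element of
T or a sum of two. These are the two types. The weight function determines the columns
(`isomorphic_of_hammingNorm_eq`), so each type is one code, and two explicit tables of 51 lines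
realise them. -/

namespace CodeClassification

open scoped Matrix

/-! ### Characters and the Walsh transform -/

/-- The message space `𝔽₂⁷`, identified with its dual by the dot product. -/
abbrev V7 := Fin 7 → ZMod 2

/-- The nontrivial additive character of `𝔽₂`. -/
def sgn (a : ZMod 2) : ℤ := if a = 0 then 1 else -1

lemma sgn_zero : sgn 0 = 1 := rfl

lemma sgn_add : ∀ a b : ZMod 2, sgn (a + b) = sgn a * sgn b := by decide

/-- The character of `𝔽₂⁷` belonging to `q`, evaluated at `p`. -/
def chi (p q : V7) : ℤ := sgn (p ⬝ᵥ q)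

lemma chi_comm (p q : V7) : chi p q = chi q p := by
  rw [chi, chi, dotProduct_comm]

lemma chi_zero_right (p : V7) : chi p 0 = 1 := by simp [chi, sgn_zero]

lemma chi_zero_left (p : V7) : chi 0 p = 1 := by simp [chi, sgn_zero]

lemma chi_add_right (p q r : V7) : chi p (q + r) = chi p q * chi p r := by
  rw [chi, dotProduct_add, sgn_add]; rfl

lemma chi_add_left (p q r : V7) : chi (p + q) r = chi p r * chi q r := by
  rw [chi, add_dotProduct, sgn_add]; rfl

lemma chi_eq_one_or (p q : V7) : chi p q = 1 ∨ chi p q = -1 := by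
  unfold chi sgn; split_ifs <;> simp

lemma chi_eq_one_iff (p q : V7) : chi p q = 1 ↔ p ⬝ᵥ q = 0 := by
  unfold chi sgn; split_ifs <;> simp_all

lemma chi_eq_neg_one_iff (p q : V7) : chi p q = -1 ↔ p ⬝ᵥ q ≠ 0 := by
  unfold chi sgn; split_ifs <;> simp_all

lemma add_self_V7 (p : V7) : p + p = 0 := CharTwo.add_self_eq_zero p

lemma add_add_cancel_V7 (p q : V7) : p + q + q = p := by rw [add_assoc, add_self_V7, add_zero]

lemma add_eq_zero_V7 {p q : V7} : p + q = 0 ↔ p = q := CharTwo.add_eq_zero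

lemma exists_chi_eq_neg_one {v : V7} (hv : v ≠ 0) : ∃ p, chi p v = -1 := by
  obtain ⟨i, hi⟩ := Function.ne_iff.mp hv
  refine ⟨Pi.single i 1, (chi_eq_neg_one_iff _ _).2 ?_⟩
  simpa using hi

lemma sum_chi_of_ne {v : V7} (hv : v ≠ 0) : ∑ p, chi p v = 0 := by
  obtain ⟨r, hr⟩ := exists_chi_eq_neg_one hv
  have h : ∑ p, chi (p + r) v = ∑ p, chi p v :=
    Fintype.sum_equiv (Equiv.addRight r) _ _ fun _ => rfl
  simp only [chi_add_left, hr, ← Finset.sum_mul] at h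
  linarith

lemma card_V7 : Fintype.card V7 = 128 := by simp [ZMod.card]

lemma sum_chi (v : V7) : ∑ p, chi p v = if v = 0 then 128 else 0 := by
  split_ifs with h
  · subst h; simp [chi_zero_right, ZMod.card]
  · exact sum_chi_of_ne h

/-- The Walsh transform of an integer valued function. -/
def walsh (f : V7 → ℤ) (p : V7) : ℤ := ∑ q, f q * chi p q

lemma walsh_zero_right (f : V7 → ℤ) : walsh f 0 = ∑ q, f q := by
  simp [walsh, chi_zero_left]

lemma sum_chi_mul_walsh (f : V7 → ℤ) (v : V7) : ∑ p, chi p v * walsh f p = 128 * f v := by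
  simp only [walsh, Finset.mul_sum]
  rw [Finset.sum_comm]
  have h (q : V7) : ∑ p, chi p v * (f q * chi p q) = if v = q then 128 * f q else 0 := by
    have : ∀ p, chi p v * (f q * chi p q) = f q * chi p (v + q) := fun p => by
      rw [chi_add_right]; ring
    simp only [this, ← Finset.mul_sum, sum_chi, add_eq_zero_V7]
    split_ifs <;> ring
  simp [h]

lemma sum_walsh (f : V7 → ℤ) : ∑ p, walsh f p = 128 * f 0 := by
  simpa [chi_zero_right] using sum_chi_mul_walsh f 0

lemma sum_walsh_sq (f : V7 → ℤ) : ∑ p, walsh f p ^ 2 = 128 * ∑ q, f q ^ 2 := by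
  have h (p : V7) : walsh f p ^ 2 = ∑ q, f q * (chi p q * walsh f p) := by
    rw [sq]; nth_rewrite 1 [walsh]; rw [Finset.sum_mul]
    exact Finset.sum_congr rfl fun q _ => by ring
  simp only [h]
  rw [Finset.sum_comm]
  simp only [← Finset.mul_sum, sum_chi_mul_walsh]
  rw [Finset.mul_sum]
  exact Finset.sum_congr rfl fun q _ => by ring

lemma walsh_injective {f g : V7 → ℤ} (h : ∀ p, walsh f p = walsh g p) : f = g := by
  funext v
  have h1 := sum_chi_mul_walsh f v
  have h2 := sum_chi_mul_walsh g v
  simp only [h] at h1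
  linarith

/-! ### Weights and residual codes -/

/-- The weight of the codeword of `p` in the code with column multiplicities `f`. -/
def wt (f : V7 → ℤ) (p : V7) : ℤ := ∑ q, if p ⬝ᵥ q = 0 then 0 else f q

lemma two_mul_wt (f : V7 → ℤ) (p : V7) : 2 * wt f p = walsh f 0 - walsh f p := by
  rw [walsh_zero_right, walsh, wt, ← Finset.sum_sub_distrib, Finset.mul_sum]
  refine Finset.sum_congr rfl fun q _ => ?_
  unfold chi sgn
  split_ifs <;> ring

lemma walsh_eq (f : V7 → ℤ) (p : V7) : walsh f p = walsh f 0 - 2 * wt f p := by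
  rw [two_mul_wt]; ring

lemma wt_zero (f : V7 → ℤ) : wt f 0 = 0 := by simp [wt]

lemma wt_nonneg {f : V7 → ℤ} (hf : ∀ q, 0 ≤ f q) (p : V7) : 0 ≤ wt f p :=
  Finset.sum_nonneg fun q _ => by split_ifs <;> simp [hf]

lemma wt_le {f : V7 → ℤ} (hf : ∀ q, 0 ≤ f q) (p : V7) : wt f p ≤ walsh f 0 := by
  rw [walsh_zero_right]
  exact Finset.sum_le_sum fun q _ => by split_ifs <;> simp [hf]

lemma le_wt {f : V7 → ℤ} (hf : ∀ q, 0 ≤ f q) {p q : V7} (h : chi p q = -1) : f q ≤ wt f p := by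
  have := Finset.single_le_sum (f := fun q => if p ⬝ᵥ q = 0 then 0 else f q)
    (fun q _ => by split_ifs <;> simp [hf]) (Finset.mem_univ q)
  simpa [wt, (chi_eq_neg_one_iff _ _).1 h] using this

lemma sum_one_sub_chi_mul_wt (f : V7 → ℤ) {v : V7} (hv : v ≠ 0) :
    ∑ p, (1 - chi p v) * wt f p = 64 * (walsh f 0 - f 0 + f v) := by
  have h (p : V7) : 2 * ((1 - chi p v) * wt f p) =
      walsh f 0 * (1 - chi p v) - walsh f p + chi p v * walsh f p := by
    rw [mul_left_comm, two_mul_wt]; ring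
  have : 2 * ∑ p, (1 - chi p v) * wt f p = 128 * (walsh f 0 - f 0 + f v) := by
    rw [Finset.mul_sum]
    simp only [h, Finset.sum_add_distrib, Finset.sum_sub_distrib, ← Finset.mul_sum, sum_walsh,
      sum_chi_mul_walsh, sum_chi_of_ne hv]
    simp [ZMod.card]; ring
  linarith

/-- The part of `f` on the hyperplane orthogonal to `p₀`. -/
def restrict (f : V7 → ℤ) (p₀ q : V7) : ℤ := if p₀ ⬝ᵥ q = 0 then f q else 0

lemma restrict_nonneg {f : V7 → ℤ} (hf : ∀ q, 0 ≤ f q) (p₀ q : V7) : 0 ≤ restrict f p₀ q := by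
  unfold restrict; split_ifs <;> simp [hf]

lemma two_mul_walsh_restrict (f : V7 → ℤ) (p₀ p : V7) :
    2 * walsh (restrict f p₀) p = walsh f p + walsh f (p + p₀) := by
  simp only [walsh, Finset.mul_sum, ← Finset.sum_add_distrib]
  refine Finset.sum_congr rfl fun q _ => ?_
  rw [chi_add_left]
  unfold restrict
  split_ifs with h
  · rw [(chi_eq_one_iff _ _).2 h]; ring
  · rw [(chi_eq_neg_one_iff _ _).2 h]; ring

lemma walsh_restrict_zero (f : V7 → ℤ) (p₀ : V7) :
    walsh (restrict f p₀) 0 = walsh f 0 - wt f p₀ := by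
  have h1 := two_mul_walsh_restrict f p₀ 0
  have h2 := two_mul_wt f p₀
  rw [zero_add] at h1
  linarith

lemma two_mul_wt_restrict (f : V7 → ℤ) (p₀ p : V7) :
    2 * wt (restrict f p₀) p = wt f p + wt f (p + p₀) - wt f p₀ := by
  have h0 := walsh_restrict_zero f p₀
  have h1 := two_mul_walsh_restrict f p₀ p
  have h2 := two_mul_wt f p
  have h3 := two_mul_wt f (p + p₀)
  have h4 := two_mul_wt (restrict f p₀) p
  linarith

lemma restrict_of_chi {f : V7 → ℤ} {p₀ q : V7} (h : chi p₀ q = 1) : restrict f p₀ q = f q :=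
  if_pos ((chi_eq_one_iff _ _).1 h)

lemma restrict_of_chi_neg {f : V7 → ℤ} {p₀ q : V7} (h : chi p₀ q = -1) : restrict f p₀ q = 0 :=
  if_neg ((chi_eq_neg_one_iff _ _).1 h)

lemma restrict_le {f : V7 → ℤ} (hf : ∀ q, 0 ≤ f q) (p₀ q : V7) : restrict f p₀ q ≤ f q := by
  unfold restrict; split_ifs <;> simp [hf]

/-! ### The Griesmer bound and its equality case -/

/-- The Griesmer bound `∑_{i<k} ⌈d/2^i⌉`. -/
def griesmer : ℕ → ℕ → ℕ
  | 0, _ => 0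
  | k + 1, d => d + griesmer k ((d + 1) / 2)

lemma griesmer_mono (k : ℕ) {d e : ℕ} (h : d ≤ e) : griesmer k d ≤ griesmer k e := by
  induction k generalizing d e with
  | zero => rfl
  | succ k ih => exact Nat.add_le_add h (ih (by omega))

/-- The Griesmer bound, for codes whose words outside a subspace `G` have weight at least `d`. -/
theorem griesmer_le (k : ℕ) (G : Submodule (ZMod 2) V7) {f : V7 → ℤ} (hf : ∀ q, 0 ≤ f q) (d : ℕ)
    (hG : Module.finrank (ZMod 2) G + k ≤ 7) (hd : ∀ p ∉ G, (d : ℤ) ≤ wt f p) :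
    (griesmer k d : ℤ) ≤ walsh f 0 := by
  induction k generalizing G f d with
  | zero =>
    rw [walsh_zero_right]
    exact Finset.sum_nonneg fun q _ => hf q
  | succ k ih =>
    classical
    have hne : (Finset.univ.filter fun p : V7 => p ∉ G).Nonempty := by
      by_contra h
      have htop : G = ⊤ := by
        rw [eq_top_iff]
        intro p _
        by_contra hp
        exact h ⟨p, by simp [hp]⟩
      rw [htop, finrank_top, Module.finrank_fin_fun] at hG
      omega
    obtain ⟨p₀, hp₀, hmin⟩ := Finset.exists_min_image _ (wt f) hne
    simp only [Finset.mem_filter, Finset.mem_univ, true_and] at hp₀ hmin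
    obtain ⟨e, he⟩ := Int.eq_ofNat_of_zero_le (wt_nonneg hf p₀)
    have hde : d ≤ e := by exact_mod_cast he ▸ hd p₀ hp₀
    -- The residual weights do not change when `p₀` is added to the message, so `p₀` joins `G`.
    -- Minimality of `p₀` makes (wt p + wt (p + p₀) − e)/2 at least e/2.
    have key := ih (G ⊔ Submodule.span (ZMod 2) {p₀}) (restrict_nonneg hf p₀) ((e + 1) / 2) ?_ ?_
    · rw [walsh_restrict_zero, he] at key
      have := griesmer_mono k (show (d + 1) / 2 ≤ (e + 1) / 2 by omega)
      rw [griesmer]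
      push_cast
      omega
    · have h1 := Submodule.finrank_add_le_finrank_add_finrank G (Submodule.span (ZMod 2) {p₀})
      have h2 := finrank_span_le_card (R := ZMod 2) ({p₀} : Set V7)
      simp only [Set.toFinset_singleton, Finset.card_singleton] at h2
      omega
    · intro p hp
      have h1 : p ∉ G := fun h => hp (Submodule.mem_sup_left h)
      have h2 : p + p₀ ∉ G := fun h => hp (by
        have := Submodule.add_mem_sup h (Submodule.mem_span_singleton_self (R := ZMod 2) p₀)
        rwa [add_add_cancel_V7] at this)
      have h3 := two_mul_wt_restrict f p₀ p
      have h4 := hmin p h1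
      have h5 := hmin _ h2
      omega

lemma walsh_sub_single (f : V7 → ℤ) (v p : V7) :
    walsh (f - Pi.single v 1) p = walsh f p - chi p v := by
  simp [walsh, sub_mul, Finset.sum_sub_distrib, Pi.single_apply]

lemma wt_sub_single (f : V7 → ℤ) (v p : V7) :
    2 * wt (f - Pi.single v 1) p = 2 * wt f p - (1 - chi p v) := by
  rw [two_mul_wt, two_mul_wt, walsh_sub_single, walsh_sub_single, chi_zero_left]; ring

lemma sub_single_nonneg {f : V7 → ℤ} (hf : ∀ q, 0 ≤ f q) {v : V7} (hv : 1 ≤ f v) (q : V7) :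
    0 ≤ (f - Pi.single v 1 : V7 → ℤ) q := by
  by_cases h : q = v
  · subst h; simpa using hv
  · simpa [h] using hf q

/-- A code attaining the Griesmer bound has no zero column. -/
lemma apply_zero_of_griesmer {k : ℕ} {G : Submodule (ZMod 2) V7} {f : V7 → ℤ}
    (hf : ∀ q, 0 ≤ f q) {d : ℕ} (hG : Module.finrank (ZMod 2) G + k ≤ 7)
    (hd : ∀ p ∉ G, (d : ℤ) ≤ wt f p) (hn : walsh f 0 ≤ griesmer k d) : f 0 = 0 := by
  by_contra h
  have h1 : 1 ≤ f 0 := by have := hf 0; omega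
  have := griesmer_le k G (sub_single_nonneg hf h1) d hG fun p hp => by
    have := wt_sub_single f 0 p
    rw [chi_zero_right] at this
    have := hd p hp
    omega
  rw [walsh_sub_single, chi_zero_right] at this
  omega

lemma exists_orthogonal_of_ne_top {M : Submodule (ZMod 2) V7} (hM : M ≠ ⊤) :
    ∃ v : V7, v ≠ 0 ∧ ∀ p ∈ M, p ⬝ᵥ v = 0 := by
  obtain ⟨φ, hφ, hle⟩ := Submodule.exists_le_ker_of_lt_top M hM.lt_top
  have key (p : V7) : p ⬝ᵥ (fun i => φ (Pi.single i 1)) = φ p := by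
    rw [LinearMap.pi_apply_eq_sum_univ φ p]
    simp [dotProduct]
    congr! with i _ j
    simp [Pi.single_apply, eq_comm]
  refine ⟨fun i => φ (Pi.single i 1), fun h => hφ ?_, fun p hp => ?_⟩
  · refine LinearMap.ext fun p => ?_
    rw [← key, h]; simp
  · rw [key]; exact hle hp

/-- In a code attaining the Griesmer bound, of length at most `2d+1`, the words of minimum weight
span. -/
lemma span_min_weight_eq_top {k : ℕ} {G : Submodule (ZMod 2) V7} {f : V7 → ℤ}
    (hf : ∀ q, 0 ≤ f q) {d : ℕ} (hG : Module.finrank (ZMod 2) G + k ≤ 7)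
    (hd : ∀ p ∉ G, (d : ℤ) ≤ wt f p) (hn : walsh f 0 ≤ griesmer k d)
    (hn' : walsh f 0 ≤ 2 * d + 1) :
    G ⊔ Submodule.span (ZMod 2) {p | p ∉ G ∧ wt f p = d} = ⊤ := by
  by_contra hne
  obtain ⟨v, hv, hort⟩ := exists_orthogonal_of_ne_top hne
  have hchi (p : V7) (hp : chi p v = -1) : (d : ℤ) + 1 ≤ wt f p := by
    rw [chi_eq_neg_one_iff] at hp
    have h1 : p ∉ G := fun h => hp (hort p (Submodule.mem_sup_left h))
    have h2 : wt f p ≠ d := fun h =>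
      hp (hort p (Submodule.mem_sup_right (Submodule.subset_span ⟨h1, h⟩)))
    have := hd p h1
    omega
  have hsum : ∑ p, (1 - chi p v) * ((d : ℤ) + 1) ≤ ∑ p, (1 - chi p v) * wt f p := by
    refine Finset.sum_le_sum fun p _ => ?_
    rcases chi_eq_one_or p v with h | h
    · simp [h]
    · have := hchi p h
      rw [h]; linarith
  rw [sum_one_sub_chi_mul_wt f hv, ← Finset.sum_mul, Finset.sum_sub_distrib, sum_chi_of_ne hv]
    at hsum
  simp only [Finset.sum_const, Finset.card_univ, card_V7] at hsum
  -- The average gives n + f v ≥ 2(d + 1) + f 0, and n ≤ 2d + 1. So `v` is a column; deleting it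
  -- costs weight only where there is one to spare.
  have h1 : 1 ≤ f v := by
    have := hf 0
    simp at hsum
    linarith
  have := griesmer_le k G (sub_single_nonneg hf h1) d hG fun p hp => by
    have h2 := wt_sub_single f v p
    have h3 := hd p hp
    rcases chi_eq_one_or p v with h | h
    · rw [h] at h2; omega
    · have := hchi p h
      rw [h] at h2; omega
  rw [walsh_sub_single, chi_zero_left] at this
  omega

/-! ### Divisibility of the weights -/

lemma even_wt_add (f : V7 → ℤ) {p q : V7} (hp : 2 ∣ wt f p) (hq : 2 ∣ wt f q) :
    2 ∣ wt f (p + q) := by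
  have := two_mul_wt_restrict f q p
  omega

lemma zmod_two_cases : ∀ a : ZMod 2, a = 0 ∨ a = 1 := by decide

lemma smul_zmod_two (P : V7 → Prop) (h0 : P 0) (a : ZMod 2) {p : V7} (hp : P p) : P (a • p) := by
  rcases zmod_two_cases a with rfl | rfl
  · simpa using h0
  · simpa using hp

lemma even_wt_of_span {f : V7 → ℤ} {s : Set V7} (hs : Submodule.span (ZMod 2) s = ⊤)
    (h : ∀ p ∈ s, 2 ∣ wt f p) (p : V7) : 2 ∣ wt f p := by
  have hp : p ∈ Submodule.span (ZMod 2) s := hs ▸ Submodule.mem_top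
  induction hp using Submodule.span_induction with
  | mem p hp => exact h p hp
  | zero => simp [wt_zero]
  | add p q _ _ hp hq => exact even_wt_add f hp hq
  | smul a p _ hp => exact smul_zmod_two (fun p => 2 ∣ wt f p) (by simp [wt_zero]) a hp

/-- From wt(q + p) = 2 · (residual weight) − wt q + wt p, an even residual makes addition of a
generator `p` preserve divisibility by 4. -/
lemma four_dvd_wt_of_span {f : V7 → ℤ} {s : Set V7} (hs : Submodule.span (ZMod 2) s = ⊤)
    (h : ∀ p ∈ s, 4 ∣ wt f p) (h' : ∀ p ∈ s, ∀ q, 2 ∣ wt (restrict f p) q) (p : V7) :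
    4 ∣ wt f p := by
  have hp : p ∈ Submodule.span (ZMod 2) s := hs ▸ Submodule.mem_top
  have key : ∀ q, 4 ∣ wt f q → 4 ∣ wt f (q + p) := by
    induction hp using Submodule.span_induction with
    | mem p hp =>
      intro q hq
      have h1 := two_mul_wt_restrict f p q
      have h2 := h p hp
      have h3 := h' p hp q
      omega
    | zero => intro q hq; simpa using hq
    | add p r _ _ hp hr => intro q hq; rw [← add_assoc]; exact hr _ (hp _ hq)
    | smul a p _ hp =>
      exact smul_zmod_two (fun p => ∀ q, 4 ∣ wt f q → 4 ∣ wt f (q + p))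
        (fun q hq => by simpa using hq) a hp
  simpa using key 0 (by simp [wt_zero])

/-- The Griesmer sum is 76 + 38 + 19 + 10 + 5 + 3 + 2 = 153, so the length is tight. -/
lemma apply_zero_eq_zero {f : V7 → ℤ} (hf : ∀ q, 0 ≤ f q) (hn : walsh f 0 = 153)
    (hd : ∀ p ≠ 0, 76 ≤ wt f p) : f 0 = 0 :=
  apply_zero_of_griesmer (k := 7) (G := ⊥) (d := 76) hf (by simp) (by simpa using hd)
    (by rw [hn]; decide)

/-- The residual code with respect to a word of weight `76` has even weights. -/
lemma even_wt_restrict {f : V7 → ℤ} (hf : ∀ q, 0 ≤ f q) (hn : walsh f 0 = 153)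
    (hd : ∀ p ≠ 0, 76 ≤ wt f p)
    {p₀ : V7} (hp₀ : wt f p₀ = 76) (p : V7) : 2 ∣ wt (restrict f p₀) p := by
  have h2 := finrank_span_le_card (R := ZMod 2) ({p₀} : Set V7)
  simp only [Set.toFinset_singleton, Finset.card_singleton] at h2
  -- The residual has length 77 = 38 + 19 + 10 + 5 + 3 + 2 = 2 · 38 + 1, again tight.
  have hspan := span_min_weight_eq_top (k := 6) (G := Submodule.span (ZMod 2) {p₀}) (d := 38)
    (restrict_nonneg hf p₀) (by omega) (fun p hp => ?_)
    (by rw [walsh_restrict_zero, hn, hp₀]; decide) (by rw [walsh_restrict_zero, hn, hp₀]; decide)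
  · rw [← Submodule.span_union] at hspan
    refine even_wt_of_span hspan (fun q hq => ?_) p
    rcases hq with hq | hq
    · rw [Set.mem_singleton_iff.1 hq]
      have := two_mul_wt_restrict f p₀ p₀
      rw [add_self_V7, wt_zero] at this
      omega
    · rw [hq.2]; decide
  · have h3 : p ≠ 0 := fun h => hp (h ▸ zero_mem _)
    have h4 : p + p₀ ≠ 0 := fun h =>
      hp ((add_eq_zero_V7.1 h).symm ▸ Submodule.mem_span_singleton_self p₀)
    have := two_mul_wt_restrict f p₀ p
    have := hd p h3
    have := hd _ h4
    push_cast
    omega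

/-- A `[153,7,76]₂`-code is doubly even. -/
theorem four_dvd_wt {f : V7 → ℤ} (hf : ∀ q, 0 ≤ f q) (hn : walsh f 0 = 153)
    (hd : ∀ p ≠ 0, 76 ≤ wt f p) (p : V7) : 4 ∣ wt f p := by
  have hspan := span_min_weight_eq_top (k := 7) (G := ⊥) (d := 76) hf (by simp)
    (by simpa using hd) (by rw [hn]; decide) (by rw [hn]; decide)
  rw [bot_sup_eq] at hspan
  refine four_dvd_wt_of_span hspan (fun q hq => ?_) (fun q hq => ?_) p
  · rw [hq.2]; decide
  · exact even_wt_restrict hf hn hd (by simpa using hq.2)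

/-! ### Small multisets with divisible weights -/

/-- The Walsh coefficients over the words with character −1 at `v` sum to −64 f v ≤ 0. -/
lemma exists_walsh_nonpos {f : V7 → ℤ} (h0 : f 0 = 0) {v : V7} (hv : v ≠ 0) (hfv : 0 ≤ f v) :
    ∃ p, chi p v = -1 ∧ walsh f p ≤ 0 := by
  by_contra! h
  have hsum : ∑ p, (1 - chi p v) * walsh f p = 128 * (f 0 - f v) := by
    simp only [sub_mul, one_mul, Finset.sum_sub_distrib, sum_walsh, sum_chi_mul_walsh, mul_sub]
  have hpos : 0 < ∑ p, (1 - chi p v) * walsh f p := by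
    obtain ⟨p₀, hp₀⟩ := exists_chi_eq_neg_one hv
    refine Finset.sum_pos' (fun p _ => ?_) ⟨p₀, Finset.mem_univ _, ?_⟩
    · rcases chi_eq_one_or p v with hp | hp
      · simp [hp]
      · rw [hp]; linarith [h p hp]
    · rw [hp₀]; linarith [h p₀ hp₀]
  rw [hsum, h0] at hpos
  linarith

lemma dvd_wt_restrict {f : V7 → ℤ} {m : ℤ} (h : ∀ p, 2 * m ∣ wt f p) (p₀ p : V7) :
    m ∣ wt (restrict f p₀) p := by
  obtain ⟨a, ha⟩ := h p
  obtain ⟨b, hb⟩ := h (p + p₀)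
  obtain ⟨c, hc⟩ := h p₀
  have := two_mul_wt_restrict f p₀ p
  rw [ha, hb, hc] at this
  exact ⟨a + b - c, by linarith⟩

lemma walsh_zero_eq_zero_of_wt {f : V7 → ℤ} (h0 : f 0 = 0) (h : ∀ p, wt f p = 0) :
    walsh f 0 = 0 := by
  have hs := sum_walsh f
  have (p : V7) : walsh f p = walsh f 0 := by rw [walsh_eq, h]; ring
  rw [Finset.sum_congr rfl fun p _ => this p, h0] at hs
  simpa [ZMod.card] using hs

/-- A multiset of `n` points all of whose weights are `0` or `(n+1)/2` is a set. -/
lemma eq_zero_or_one_of_two_weights {f : V7 → ℤ} (h0 : f 0 = 0)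
    (h : ∀ p, wt f p = 0 ∨ 2 * wt f p = walsh f 0 + 1) (q : V7) : f q = 0 ∨ f q = 1 := by
  -- With n points, the Walsh values are n and −1, roots of W² = (n − 1)W + n. Summing over all
  -- words gives Σ f² = Σ f.
  have hsum : ∑ p, walsh f p ^ 2 = ∑ p, ((walsh f 0 - 1) * walsh f p + walsh f 0) := by
    refine Finset.sum_congr rfl fun p _ => ?_
    have h1 := walsh_eq f p
    rcases h p with h2 | h2
    · rw [h2] at h1; rw [h1]; ring
    · rw [h2] at h1; rw [h1]; ring
  rw [sum_walsh_sq, Finset.sum_add_distrib, ← Finset.mul_sum, sum_walsh, h0] at hsum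
  simp only [Finset.sum_const, Finset.card_univ, card_V7] at hsum
  have hz : ∑ q, (f q ^ 2 - f q) = 0 := by
    rw [Finset.sum_sub_distrib, ← walsh_zero_right f]
    simp at hsum
    linarith
  have hnn : ∀ q ∈ Finset.univ, 0 ≤ f q ^ 2 - f q := fun q _ => by
    rcases le_or_gt (f q) 0 with h | h
    · nlinarith
    · nlinarith
  have := (Finset.sum_eq_zero_iff_of_nonneg hnn).1 hz q (Finset.mem_univ q)
  have : f q * (f q - 1) = 0 := by linarith
  rcases mul_eq_zero.1 this with h | h
  · exact Or.inl h
  · exact Or.inr (by linarith)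

/-- If the hyperplanes with nonpositive Walsh coefficient carry no multiple point, then there is
at most one multiple point. -/
lemma multiple_point_unique {f : V7 → ℤ} (hf : ∀ q, 0 ≤ f q) (h0 : f 0 = 0)
    (h : ∀ p, walsh f p ≤ 0 → ∀ q, restrict f p q ≤ 1) {b c : V7} (hb : 2 ≤ f b) (hc : 2 ≤ f c) :
    b = c := by
  by_contra hbc
  have hv : b + c ≠ 0 := fun h => hbc (add_eq_zero_V7.1 h)
  -- This `p` separates `b` from `c`, so its hyperplane contains exactly one of the two multiple
  -- points.
  obtain ⟨p, hp, hw⟩ := exists_walsh_nonpos h0 hv (hf _)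
  rw [chi_add_right] at hp
  rcases chi_eq_one_or p b with h1 | h1
  · have := h p hw b
    rw [restrict_of_chi h1] at this
    omega
  · have h2 : chi p c = 1 := by rw [h1] at hp; linarith
    have := h p hw c
    rw [restrict_of_chi h2] at this
    omega

lemma sum_sq_sub_of_unique {f : V7 → ℤ} (hf : ∀ q, 0 ≤ f q) {b : V7}
    (hb : ∀ c, 2 ≤ f c → c = b) : ∑ q, f q ^ 2 = walsh f 0 + (f b ^ 2 - f b) := by
  have : ∑ q, (f q ^ 2 - f q) = f b ^ 2 - f b := by
    refine Finset.sum_eq_single b (fun c _ hc => ?_) (by simp)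
    have h1 : ¬ 2 ≤ f c := fun h => hc (hb c h)
    have h2 := hf c
    obtain h | h : f c = 0 ∨ f c = 1 := by omega
    · rw [h]; norm_num
    · rw [h]; norm_num
  rw [Finset.sum_sub_distrib, ← walsh_zero_right f] at this
  linarith

lemma exists_unique_multiple {f : V7 → ℤ} (hf : ∀ q, 0 ≤ f q) (h0 : f 0 = 0)
    (h : ∀ p, walsh f p ≤ 0 → ∀ q, restrict f p q ≤ 1) : ∃ b, ∀ c, 2 ≤ f c → c = b := by
  by_cases hb : ∃ b, 2 ≤ f b
  · obtain ⟨b, hb⟩ := hb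
    exact ⟨b, fun c hc => multiple_point_unique hf h0 h hc hb⟩
  · exact ⟨0, fun c hc => (hb ⟨c, hc⟩).elim⟩

lemma restrict_zero {f : V7 → ℤ} (h0 : f 0 = 0) (p : V7) : restrict f p 0 = 0 := by
  simp [restrict, h0]

/-- A doubly even multiset of `11` points has exactly one multiple point, and its multiplicity is
at least `4`. -/
lemma exists_multiple_of_eleven {f : V7 → ℤ} (hf : ∀ q, 0 ≤ f q) (h0 : f 0 = 0)
    (hn : walsh f 0 = 11) (hdiv : ∀ p, 4 ∣ wt f p) :
    ∃ b, 4 ≤ f b ∧ ∀ c, 2 ≤ f c → c = b := by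
  have hw (p : V7) : wt f p = 0 ∨ wt f p = 4 ∨ wt f p = 8 := by
    have h1 := wt_nonneg hf p
    have h2 := wt_le hf p
    have h3 := hdiv p
    omega
  -- Only weight 8 makes 11 − 2 wt nonpositive. It leaves three points with weights 0 or 2, hence a
  -- set.
  have hres : ∀ p, walsh f p ≤ 0 → ∀ q, restrict f p q ≤ 1 := by
    intro p hp q
    have h1 := walsh_eq f p
    have h2 : wt f p = 8 := by rcases hw p with h | h | h <;> omega
    have h3 := walsh_restrict_zero f p
    have := eq_zero_or_one_of_two_weights (restrict_zero h0 p) (fun r => by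
      have h4 := wt_nonneg (restrict_nonneg hf p) r
      have h5 := wt_le (restrict_nonneg hf p) r
      have h6 := dvd_wt_restrict (m := 2) hdiv p r
      omega) q
    omega
  obtain ⟨b, hb⟩ := exists_unique_multiple hf h0 hres
  refine ⟨b, ?_, hb⟩
  have hsq := sum_sq_sub_of_unique hf hb
  have hW := sum_walsh f
  have hW2 := sum_walsh_sq f
  rw [h0] at hW
  have hfb := hf b
  by_cases hm : 2 ≤ f b
  -- Hyperplanes through `b` have W in {11, 3}, the others W in {3, −5}. The two quadratic relations
  -- are merged by means of the character; summing gives m² − 9m + 20 = 0 for m = f b.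
  · have key (p : V7) : walsh f p ^ 2 =
        6 * walsh f p + 8 * (chi p b * walsh f p) - 24 * chi p b - 9 := by
      have h1 := walsh_eq f p
      rcases chi_eq_one_or p b with h2 | h2
      · have h3 : wt f p ≠ 8 := fun h => by
          have := hres p (by omega) b
          rw [restrict_of_chi h2] at this
          omega
        rw [h2]
        rcases hw p with h | h | h
        · rw [h1, h, hn]; norm_num
        · rw [h1, h, hn]; norm_num
        · exact (h3 h).elim
      · have h3 := le_wt hf h2
        rw [h2]
        rcases hw p with h | h | h
        · omega
        · rw [h1, h, hn]; norm_num
        · rw [h1, h, hn]; norm_num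
    have hb0 : b ≠ 0 := fun h => by rw [h, h0] at hm; omega
    have hs := Finset.sum_congr rfl fun p (_ : p ∈ Finset.univ) => key p
    simp only [Finset.sum_sub_distrib, Finset.sum_add_distrib, ← Finset.mul_sum, hW, hW2, hsq,
      sum_chi_mul_walsh, sum_chi_of_ne hb0, hn, Finset.sum_const, Finset.card_univ, card_V7] at hs
    have : (f b - 4) * (f b - 5) = 0 := by
      simp at hs
      linarith
    rcases mul_eq_zero.1 this with h | h <;> omega
  · exfalso
    have hle : f b ^ 2 - f b ≤ 0 := by nlinarith
    -- (W − 3)(W + 5) is nonnegative on the values 11, 3, −5, but for a set its sum is 128 · (11 −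
    -- 15).
    have : 0 ≤ ∑ p, (walsh f p ^ 2 + 2 * walsh f p - 15) := by
      refine Finset.sum_nonneg fun p _ => ?_
      have h1 := walsh_eq f p
      rcases hw p with h | h | h <;> rw [h1, h, hn] <;> norm_num
    simp only [Finset.sum_sub_distrib, Finset.sum_add_distrib, ← Finset.mul_sum, hW, hW2, hsq,
      hn, Finset.sum_const, Finset.card_univ, card_V7] at this
    simp at this
    linarith

/-- A triply even multiset of `23` points has a point of multiplicity at least `7`. -/
lemma exists_multiple_of_twenty_three {f : V7 → ℤ} (hf : ∀ q, 0 ≤ f q) (h0 : f 0 = 0)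
    (hn : walsh f 0 = 23) (hdiv : ∀ p, 8 ∣ wt f p) : ∃ b, 7 ≤ f b := by
  have hw (p : V7) : wt f p = 0 ∨ wt f p = 8 ∨ wt f p = 16 := by
    have h1 := wt_nonneg hf p
    have h2 := wt_le hf p
    have h3 := hdiv p
    omega
  have hres : ∀ p, walsh f p ≤ 0 → ∀ q, restrict f p q ≤ 1 := by
    intro p hp q
    have h1 := walsh_eq f p
    have h2 : wt f p = 16 := by rcases hw p with h | h | h <;> omega
    have h3 := walsh_restrict_zero f p
    have := eq_zero_or_one_of_two_weights (restrict_zero h0 p) (fun r => by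
      have h4 := wt_nonneg (restrict_nonneg hf p) r
      have h5 := wt_le (restrict_nonneg hf p) r
      have h6 := dvd_wt_restrict (m := 4) hdiv p r
      omega) q
    omega
  obtain ⟨b, hb⟩ := exists_unique_multiple hf h0 hres
  refine ⟨b, ?_⟩
  have hsq := sum_sq_sub_of_unique hf hb
  have hfb := hf b
  -- (W − 7)(W + 9) is nonnegative on the values 23, 7, −9, so m = f b satisfies m² − m ≥ 40.
  have : 0 ≤ ∑ p, (walsh f p ^ 2 + 2 * walsh f p - 63) := by
    refine Finset.sum_nonneg fun p _ => ?_
    have h1 := walsh_eq f p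
    rcases hw p with h | h | h <;> rw [h1, h, hn] <;> norm_num
  simp only [Finset.sum_sub_distrib, Finset.sum_add_distrib, ← Finset.mul_sum, sum_walsh,
    sum_walsh_sq, hsq, h0, hn, Finset.sum_const, Finset.card_univ, card_V7] at this
  simp at this
  by_contra! h
  nlinarith

/-- A triply even multiset of `15` points is the set of nonzero vectors of a subspace of
dimension `4`. -/
lemma exists_subspace_of_fifteen {f : V7 → ℤ} (hf : ∀ q, 0 ≤ f q) (h0 : f 0 = 0)
    (hn : walsh f 0 = 15) (hdiv : ∀ p, 8 ∣ wt f p) :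
    ∃ D : Submodule (ZMod 2) V7, Module.finrank (ZMod 2) D = 4 ∧
      ∀ q ≠ 0, (q ∈ D → f q = 1) ∧ (q ∉ D → f q = 0) := by
  have hw (p : V7) : wt f p = 0 ∨ wt f p = 8 := by
    have h1 := wt_nonneg hf p
    have h2 := wt_le hf p
    have h3 := hdiv p
    omega
  have h01 := eq_zero_or_one_of_two_weights h0 fun p => by
    rcases hw p with h | h <;> omega
  -- The span of the support, described as the orthogonal complement of the words of weight zero.
  let D : Submodule (ZMod 2) V7 :=
    { carrier := {q | ∀ p, wt f p = 0 → p ⬝ᵥ q = 0}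
      add_mem' := fun ha hb p hp => by rw [dotProduct_add, ha p hp, hb p hp, add_zero]
      zero_mem' := fun p _ => dotProduct_zero p
      smul_mem' := fun a q hq p hp => by rw [dotProduct_smul, hq p hp, smul_zero] }
  have hD (q : V7) : q ∈ D ↔ ∀ p, wt f p = 0 → p ⬝ᵥ q = 0 := Iff.rfl
  have hmem : ∀ q ≠ 0, q ∈ D → f q = 1 := by
    intro q hq hqD
    -- The Walsh values are 15 and −1, and on 15 the character at `q` is 1; so (χ − 1)(W + 1) = 0
    -- throughout.
    have key (p : V7) : chi p q * walsh f p + chi p q = walsh f p + 1 := by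
      have h1 := walsh_eq f p
      rcases hw p with h | h
      · rw [(chi_eq_one_iff _ _).2 ((hD q).1 hqD p h)]; ring
      · have : walsh f p = -1 := by omega
        rw [this]; ring
    have hs := Finset.sum_congr rfl fun p (_ : p ∈ Finset.univ) => key p
    simp only [Finset.sum_add_distrib, sum_chi_mul_walsh, sum_chi_of_ne hq, sum_walsh, h0,
      Finset.sum_const, Finset.card_univ, card_V7] at hs
    simp at hs
    linarith
  have hnot : ∀ q, q ∉ D → f q = 0 := by
    intro q hq
    rcases h01 q with h | h
    · exact h
    · refine (hq ((hD q).2 fun p hp => ?_)).elim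
      by_contra hpq
      have := le_wt hf ((chi_eq_neg_one_iff p q).2 hpq)
      omega
  refine ⟨D, ?_, fun q hq => ⟨hmem q hq, hnot q⟩⟩
  classical
  have hcard : ((Finset.univ.filter fun q => q ∈ D).card : ℤ) = 16 := by
    have h1 : ∑ q, (if q ∈ D then (1 : ℤ) else 0) = ∑ q, (f q + if q = 0 then 1 else 0) := by
      refine Finset.sum_congr rfl fun q _ => ?_
      by_cases hq : q = 0
      · subst hq; simp [h0]
      · by_cases hqD : q ∈ D
        · simp [hq, hqD, hmem q hq hqD]
        · simp [hq, hqD, hnot q hqD]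
    rw [Finset.sum_boole, Finset.sum_add_distrib, ← walsh_zero_right, hn] at h1
    rw [h1]; simp
  have h16 : Fintype.card D = 16 := by
    rw [Fintype.card_subtype]; exact_mod_cast hcard
  have := Module.card_eq_pow_finrank (K := ZMod 2) (V := D)
  rw [h16, ZMod.card] at this
  exact Nat.pow_right_injective le_rfl (this.symm.trans (by norm_num : 16 = 2 ^ 4))

lemma chi_sum (p : V7) (T : Finset V7) : chi p (∑ b ∈ T, b) = ∏ b ∈ T, chi p b := by
  classical
  induction T using Finset.induction_on with
  | empty => simp [chi_zero_right]
  | insert a s ha ih => rw [Finset.sum_insert ha, Finset.prod_insert ha, chi_add_right, ih]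

/-- Each 1 − χ is 0 or 2, and the number of `b` in `T` not orthogonal to `p` has the parity of `p`
dotted with their sum. -/
lemma four_dvd_sum_one_sub_chi (p : V7) (T : Finset V7) :
    4 ∣ ∑ b ∈ T, (1 - chi p b) - (1 - chi p (∑ b ∈ T, b)) := by
  classical
  induction T using Finset.induction_on with
  | empty => simp [chi_zero_right]
  | insert a s ha ih =>
    rw [Finset.sum_insert ha, Finset.sum_insert ha, chi_add_right]
    rcases chi_eq_one_or p a with h | h <;>
    rcases chi_eq_one_or p (∑ b ∈ s, b) with h' | h' <;>
    rw [h'] at ih <;> rw [h, h'] <;> omega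

/-- Subtracting four times a set with sum zero preserves divisibility of the weights by `8`. -/
lemma eight_dvd_wt_sub {f g : V7 → ℤ} (hdiv : ∀ p, 8 ∣ wt f p) {T : Finset V7}
    (hT : ∑ b ∈ T, b = 0) (hg : ∀ q, g q = f q - 4 * if q ∈ T then 1 else 0) :
    walsh g 0 = walsh f 0 - 4 * T.card ∧ ∀ p, 8 ∣ wt g p := by
  have hw (p : V7) : walsh g p = walsh f p - 4 * ∑ b ∈ T, chi p b := by
    simp only [walsh, hg, sub_mul, Finset.sum_sub_distrib, mul_assoc, ← Finset.mul_sum]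
    simp
  refine ⟨by rw [hw]; simp [chi_zero_left], fun p => ?_⟩
  have h1 := two_mul_wt f p
  have h2 := two_mul_wt g p
  have h3 := four_dvd_sum_one_sub_chi p T
  have h4 := hw p
  have h5 := hw 0
  have h6 := hdiv p
  rw [hT, chi_zero_right, Finset.sum_sub_distrib] at h3
  simp only [chi_zero_left] at h5
  omega

/-! ### Triply even multisets of 35 points -/

section ThirtyFive

variable {x : V7 → ℤ}

/-- Triply even multisets of `35` points spanning `𝔽₂⁷`, without points of multiplicity above
`6`. -/
structure IsTriplyEven35 (x : V7 → ℤ) : Prop where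
  nonneg : ∀ q, 0 ≤ x q
  le_six : ∀ q, x q ≤ 6
  zero : x 0 = 0
  total : walsh x 0 = 35
  dvd : ∀ p, 8 ∣ wt x p
  spanning : ∀ p ≠ 0, 8 ≤ wt x p

namespace IsTriplyEven35

lemma wt_cases (h : IsTriplyEven35 x) {p : V7} (hp : p ≠ 0) :
    wt x p = 8 ∨ wt x p = 16 ∨ wt x p = 24 := by
  have h1 := h.spanning p hp
  have h2 := wt_le h.nonneg p
  have h3 := h.dvd p
  have h4 := h.total
  -- Weight 32 would leave three points with all weights divisible by 4, hence zero.
  have h5 : wt x p ≠ 32 := fun h5 => by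
    have h6 := walsh_restrict_zero x p
    have := walsh_zero_eq_zero_of_wt (restrict_zero h.zero p) fun r => by
      have h7 := wt_nonneg (restrict_nonneg h.nonneg p) r
      have h8 := wt_le (restrict_nonneg h.nonneg p) r
      have h9 := dvd_wt_restrict (m := 4) h.dvd p r
      omega
    omega
  omega

lemma walsh_ge (h : IsTriplyEven35 x) {p : V7} (hp : wt x p ≠ 24) : 3 ≤ walsh x p := by
  have h1 := walsh_eq x p
  have h2 := h.total
  by_cases h0 : p = 0
  · subst h0; omega
  · rcases h.wt_cases h0 with h | h | h <;> omega

lemma exists_wt_eq (h : IsTriplyEven35 x) : ∃ p, wt x p = 24 := by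
  by_contra! hp
  have h1 := sum_walsh x
  have h2 : ∑ _p : V7, (3 : ℤ) ≤ ∑ p, walsh x p := Finset.sum_le_sum fun p _ => h.walsh_ge (hp p)
  rw [h1, h.zero] at h2
  simp at h2

/-- The hyperplane of a word of weight 24 carries 11 points with doubly even weights. -/
lemma exists_unique_heavy (h : IsTriplyEven35 x) {p : V7} (hp : wt x p = 24) :
    ∃ b, 4 ≤ x b ∧ chi p b = 1 ∧ ∀ c, 4 ≤ x c → c ≠ b → chi p c = -1 := by
  have htot := walsh_restrict_zero x p
  have hx := h.total
  obtain ⟨b, hb, hu⟩ := exists_multiple_of_eleven (restrict_nonneg h.nonneg p)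
    (restrict_zero h.zero p) (by omega) (dvd_wt_restrict (m := 4) h.dvd p)
  refine ⟨b, hb.trans (restrict_le h.nonneg p b), ?_, fun c hc hcb => ?_⟩
  · rcases chi_eq_one_or p b with h1 | h1
    · exact h1
    · rw [restrict_of_chi_neg h1] at hb; omega
  · rcases chi_eq_one_or p c with h1 | h1
    · exact (hcb (hu c (by rw [restrict_of_chi h1]; omega))).elim
    · exact h1

/-- Exactly one heavy point lies in the hyperplane, so all other factors of the character product
are −1. -/
lemma chi_sum_heavy (h : IsTriplyEven35 x) {S : Finset V7} (hS : ∀ q, q ∈ S ↔ 4 ≤ x q) {p : V7}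
    (hp : wt x p = 24) : chi p (∑ b ∈ S, b) = (-1) ^ (S.card + 1) := by
  obtain ⟨b, hb, hb1, hb2⟩ := h.exists_unique_heavy hp
  have hbS := (hS b).2 hb
  rw [chi_sum, ← Finset.mul_prod_erase S _ hbS, hb1, one_mul,
    Finset.prod_congr rfl fun c hc => hb2 c ((hS c).1 (Finset.mem_of_mem_erase hc))
      (Finset.ne_of_mem_erase hc), Finset.prod_const, ← Finset.card_erase_add_one hbS, pow_add,
    pow_add]
  simp

/-- There is an odd number of heavy points with sum zero. -/
lemma exists_odd_set (h : IsTriplyEven35 x) :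
    ∃ T : Finset V7, (∀ q ∈ T, 4 ≤ x q) ∧ Odd T.card ∧ ∑ b ∈ T, b = 0 := by
  classical
  let S : Finset V7 := Finset.univ.filter fun q => 4 ≤ x q
  have hS (q : V7) : q ∈ S ↔ 4 ≤ x q := by simp [S]
  rcases Nat.even_or_odd S.card with hev | hodd
  · have hchi {p : V7} (hp : wt x p = 24) : chi p (∑ b ∈ S, b) = -1 := by
      rw [h.chi_sum_heavy hS hp]; exact hev.add_one.neg_one_pow
    set v := ∑ b ∈ S, b with hv
    have hv0 : v ≠ 0 := fun h0 => by
      obtain ⟨p, hp⟩ := h.exists_wt_eq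
      have := hchi hp
      rw [h0, chi_zero_right] at this
      omega
    -- Where the character at `v` is 1 the weight is not 24, so W ≥ 3 and every term is nonnegative.
    -- The term of 0 alone is 64, so 64 ≤ 128 x(v) − 384 and x(v) ≥ 4.
    have hvS : v ∈ S := by
      have h1 : (1 + chi 0 v) * (walsh x 0 - 3) ≤ ∑ p, (1 + chi p v) * (walsh x p - 3) := by
        refine Finset.single_le_sum (f := fun p => (1 + chi p v) * (walsh x p - 3))
          (fun p _ => ?_) (Finset.mem_univ 0)
        rcases chi_eq_one_or p v with h2 | h2
        · have h3 : wt x p ≠ 24 := fun h3 => by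
            have := hchi h3
            omega
          have := h.walsh_ge h3
          rw [h2]; linarith
        · simp [h2]
      have h2 : ∑ p, (1 + chi p v) * (walsh x p - 3) = 128 * x 0 + 128 * x v - 384 := by
        have (p : V7) : (1 + chi p v) * (walsh x p - 3) =
            walsh x p + chi p v * walsh x p - 3 * chi p v - 3 := by ring
        simp only [this, Finset.sum_sub_distrib, Finset.sum_add_distrib, ← Finset.mul_sum,
          sum_walsh, sum_chi_mul_walsh, sum_chi_of_ne hv0, Finset.sum_const, Finset.card_univ,
          card_V7]
        simp
      rw [h2, h.total, h.zero, chi_zero_left] at h1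
      rw [hS]; omega
    refine ⟨S.erase v, fun q hq => (hS q).1 (Finset.mem_of_mem_erase hq), ?_, ?_⟩
    · have := Finset.card_erase_add_one hvS
      rw [← this, Nat.even_add_one, Nat.not_even_iff_odd] at hev
      exact hev
    · have := Finset.add_sum_erase S (fun b => b) hvS
      rw [← hv] at this
      simpa using this
  · refine ⟨S, fun q => (hS q).1, hodd, ?_⟩
    by_contra hv
    -- W(p) ≤ 0 forces weight 24, where the character of the sum is 1 because the number of heavy
    -- points is odd.
    obtain ⟨p, hp, hw⟩ := exists_walsh_nonpos h.zero hv (h.nonneg _)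
    have h1 : wt x p = 24 := by
      by_contra h1
      have := h.walsh_ge h1
      omega
    rw [h.chi_sum_heavy hS h1, hodd.add_one.neg_one_pow] at hp
    omega

/-- Such a multiset is the sum of a subspace of dimension `4` and four times a set of five vectors
with sum zero. -/
theorem exists_decomposition (h : IsTriplyEven35 x) :
    ∃ (D : Submodule (ZMod 2) V7) (T : Finset V7), Module.finrank (ZMod 2) D = 4 ∧ T.card = 5 ∧
      (0 : V7) ∉ T ∧ ∑ b ∈ T, b = 0 ∧
      ∀ q ≠ 0, (q ∈ D → x q = 1 + 4 * if q ∈ T then 1 else 0) ∧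
        (q ∉ D → x q = 4 * if q ∈ T then 1 else 0) := by
  obtain ⟨T, hT, hodd, hsum⟩ := h.exists_odd_set
  have h0T : (0 : V7) ∉ T := fun h0 => by
    have := hT 0 h0
    rw [h.zero] at this
    omega
  let g : V7 → ℤ := fun q => x q - 4 * if q ∈ T then 1 else 0
  have hg (q : V7) : g q = x q - 4 * if q ∈ T then 1 else 0 := rfl
  obtain ⟨htot, hdiv⟩ := eight_dvd_wt_sub h.dvd hsum hg
  have hnn (q : V7) : 0 ≤ g q := by
    rw [hg]
    split_ifs with hq
    · have := hT q hq; omega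
    · have := h.nonneg q; omega
  have hg0 : g 0 = 0 := by rw [hg, if_neg h0T, h.zero]; rfl
  have hpos : 0 ≤ walsh g 0 := (wt_nonneg hnn 0).trans (wt_le hnn 0)
  rw [h.total] at htot
  have hcases : T.card = 1 ∨ T.card = 3 ∨ T.card = 5 ∨ T.card = 7 := by
    obtain ⟨k, hk⟩ := hodd
    omega
  rcases hcases with hc | hc | hc | hc
  · obtain ⟨a, rfl⟩ := Finset.card_eq_one.1 hc
    rw [Finset.sum_singleton] at hsum
    exact (h0T (by simp [hsum])).elim
  · obtain ⟨b, hb⟩ := exists_multiple_of_twenty_three hnn hg0 (by rw [htot, hc]; rfl) hdiv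
    have := h.le_six b
    rw [hg] at hb
    split_ifs at hb <;> omega
  · obtain ⟨D, hD, hDg⟩ := exists_subspace_of_fifteen hnn hg0 (by rw [htot, hc]; rfl) hdiv
    refine ⟨D, T, hD, hc, h0T, hsum, fun q hq => ⟨fun hqD => ?_, fun hqD => ?_⟩⟩
    · have := (hDg q hq).1 hqD
      rw [hg] at this; linarith
    · have := (hDg q hq).2 hqD
      rw [hg] at this; linarith
  · have := walsh_zero_eq_zero_of_wt hg0 fun p => by
      have h1 := wt_nonneg hnn p
      have h2 := wt_le hnn p
      have h3 := hdiv p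
      omega
    omega

end IsTriplyEven35

end ThirtyFive

/-! ### Normal forms -/

/-- The vectors `e₁, e₂, e₃, e₄, e₁ + e₂ + e₃ + e₄`. -/
def frame (i : Fin 5) : Fin 4 → ZMod 2 :=
  fun j => if (i : ℕ) = 4 ∨ (i : ℕ) = j then 1 else 0

/-- The first four coordinates. -/
def head : V7 →ₗ[ZMod 2] Fin 4 → ZMod 2 := LinearMap.funLeft _ _ (Fin.castAdd 3)

/-- The last three coordinates. -/
def tail : V7 →ₗ[ZMod 2] Fin 3 → ZMod 2 := LinearMap.funLeft _ _ (Fin.natAdd 4)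

instance (p : V7) : Decidable (∃ i, head p = frame i) := by unfold head; infer_instance

/-- The normal form of the excess of the weights over the minimum weight. -/
def excess (a : Fin 4 → ZMod 2) (p : V7) : ℤ :=
  (if head p = 0 ∨ head p = a then 1 else 0) +
    4 * if tail p = 0 ∧ ∃ i, head p = frame i then 1 else 0

lemma head_tail_ext {p : V7} (h : head p = 0) (h' : tail p = 0) : p = 0 := by
  funext i
  refine Fin.addCases (m := 4) (n := 3) (fun j => ?_) (fun j => ?_) i
  · exact congrFun h j
  · exact congrFun h' j

/-- The 15 nonzero vectors of 𝔽₂⁴ are the 5 frame vectors and their 10 pairwise sums; the two cases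
become the two codes. -/
lemma frame_cover : ∀ a : Fin 4 → ZMod 2, a ≠ 0 →
    (∃ i, a = frame i) ∨ ∃ i j, i ≠ j ∧ a = frame i + frame j := by decide +kernel

lemma frame_last : frame 4 = frame 0 + frame 1 + frame 2 + frame 3 := by decide

lemma exists_perm_pair : ∀ i j : Fin 5, i ≠ j →
    ∃ σ : Equiv.Perm (Fin 5), σ 0 = i ∧ σ 1 = j := fun i j h =>
  ⟨Equiv.swap 0 i * Equiv.swap 1 (Equiv.swap 0 i j), by decide +revert, by decide +revert⟩

/-- The linear map sending the frame to five vectors with sum zero. -/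
def frameMap (t : Fin 5 → V7) : (Fin 4 → ZMod 2) →ₗ[ZMod 2] V7 :=
  Fintype.linearCombination (ZMod 2) (fun i : Fin 4 => t i.castSucc)

lemma frameMap_frame {t : Fin 5 → V7} (ht : ∑ i, t i = 0) (i : Fin 5) :
    frameMap t (frame i) = t i := by
  have key : ∀ i : Fin 4, frameMap t (frame i.castSucc) = t i.castSucc := by
    intro i
    have : frame i.castSucc = Pi.single i 1 := by decide +revert
    rw [this, frameMap, Fintype.linearCombination_apply_single, one_smul]
  refine Fin.lastCases ?_ key i
  have h : t 0 + t 1 + t 2 + t 3 + t 4 = 0 := by rw [← Fin.sum_univ_five]; exact ht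
  have h0 := key 0
  have h1 := key 1
  have h2 := key 2
  have h3 := key 3
  change frameMap t (frame 4) = t 4
  rw [frame_last, map_add, map_add, map_add]
  simp only [Fin.castSucc] at h0 h1 h2 h3
  exact (congrArg₂ _ (congrArg₂ _ (congrArg₂ _ h0 h1) h2) h3).trans (add_eq_zero_V7.1 h)

lemma frameMap_injective {t : Fin 5 → V7} (ht : ∑ i, t i = 0) (hinj : Function.Injective t)
    (h0 : ∀ i, t i ≠ 0) : Function.Injective (frameMap t) := by
  rw [injective_iff_map_eq_zero]
  intro a ha
  by_contra hne
  rcases frame_cover a hne with ⟨i, rfl⟩ | ⟨i, j, hij, rfl⟩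
  · rw [frameMap_frame ht] at ha
    exact h0 i ha
  · rw [map_add, frameMap_frame ht, frameMap_frame ht] at ha
    exact hij (hinj (add_eq_zero_V7.1 ha))

/-- A line in a `4`-dimensional space has a complement, parametrized by `𝔽₂³`. -/
lemma exists_complement {D : Submodule (ZMod 2) V7} (hD : Module.finrank (ZMod 2) D = 4) {z : V7}
    (hz : z ∈ D) (hz0 : z ≠ 0) :
    ∃ δ : (Fin 3 → ZMod 2) →ₗ[ZMod 2] V7, Function.Injective δ ∧ (∀ b, δ b ∈ D) ∧
      ∀ b, δ b ≠ z := by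
  obtain ⟨Q, hQ⟩ := Submodule.exists_isCompl (Submodule.span (ZMod 2) {z})
  have h1 := Submodule.finrank_add_eq_of_isCompl hQ
  rw [finrank_span_singleton hz0, Module.finrank_fin_fun] at h1
  -- As `z` lies in `D`, the sum with `Q` is everything, so the intersection has dimension 4 + 6 − 7
  -- = 3.
  have h2 : D ⊔ Q = ⊤ := by
    rw [eq_top_iff, ← hQ.sup_eq_top]
    exact sup_le_sup_right ((Submodule.span_singleton_le_iff_mem z D).2 hz) Q
  have h3 := Submodule.finrank_sup_add_finrank_inf_eq D Q
  rw [h2, finrank_top, Module.finrank_fin_fun, hD] at h3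
  have h4 : Module.finrank (ZMod 2) (Fin 3 → ZMod 2) =
      Module.finrank (ZMod 2) (D ⊓ Q : Submodule _ _) := by
    rw [Module.finrank_fin_fun]; omega
  let δ := LinearEquiv.ofFinrankEq _ _ h4
  refine ⟨(D ⊓ Q).subtype ∘ₗ δ.toLinearMap, Subtype.val_injective.comp δ.injective,
    fun b => (δ b).2.1, fun b hb => hz0 ?_⟩
  have hzQ : z ∈ Q := hb ▸ (δ b).2.2
  exact Submodule.disjoint_def.1 hQ.disjoint z (Submodule.mem_span_singleton_self z) hzQ

lemma exists_normalizing_map {D : Submodule (ZMod 2) V7} (hD : Module.finrank (ZMod 2) D = 4)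
    {t : Fin 5 → V7} (ht : ∑ i, t i = 0) (hinj : Function.Injective t) (h0 : ∀ i, t i ≠ 0)
    {a : Fin 4 → ZMod 2} (ha : a ≠ 0) (haD : ∀ b, frameMap t b ∈ D ↔ b = 0 ∨ b = a) :
    ∃ L : V7 ≃ₗ[ZMod 2] V7, (∀ p, L p ∈ D ↔ head p = 0 ∨ head p = a) ∧
      ∀ p, L p ∈ Set.range t ↔ tail p = 0 ∧ ∃ i, head p = frame i := by
  have hτ := frameMap_injective ht hinj h0
  obtain ⟨δ, hδ, hδD, hδz⟩ := exists_complement hD ((haD a).2 (Or.inr rfl))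
    (fun h => ha (hτ (h.trans (map_zero _).symm)))
  have key {b : Fin 4 → ZMod 2} {c : Fin 3 → ZMod 2} (h : frameMap t b + δ c = 0) :
      b = 0 ∧ c = 0 := by
    have h1 : frameMap t b = δ c := add_eq_zero_V7.1 h
    rcases (haD b).1 (h1 ▸ hδD c) with rfl | rfl
    · exact ⟨rfl, hδ (by rw [← h1, map_zero, map_zero])⟩
    · exact (hδz c h1.symm).elim
  -- The span of `t` has dimension 4 and meets `D` only in {0, z}; the image of `δ` is a
  -- 3-dimensional part of `D` avoiding `z`, so the two are complementary.
  let M : V7 →ₗ[ZMod 2] V7 := frameMap t ∘ₗ head + δ ∘ₗ tail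
  have hM (p : V7) : M p = frameMap t (head p) + δ (tail p) := rfl
  have hMinj : Function.Injective M := by
    rw [injective_iff_map_eq_zero]
    intro p hp
    obtain ⟨h1, h2⟩ := key hp
    exact head_tail_ext h1 h2
  refine ⟨LinearEquiv.ofInjectiveEndo M hMinj, fun p => ?_, fun p => ?_⟩
  · rw [LinearEquiv.coe_ofInjectiveEndo, hM, ← haD]
    exact Submodule.add_mem_iff_left D (hδD _)
  · rw [LinearEquiv.coe_ofInjectiveEndo, hM]
    constructor
    · rintro ⟨i, hi⟩
      rw [← frameMap_frame ht] at hi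
      have h1 : frameMap t (head p + frame i) + δ (tail p) = 0 := by
        rw [map_add, hi, add_right_comm]; exact add_self_V7 _
      obtain ⟨h2, h3⟩ := key h1
      exact ⟨h3, i, CharTwo.add_eq_zero.1 h2⟩
    · rintro ⟨h1, i, hi⟩
      exact ⟨i, by rw [h1, hi, map_zero, add_zero, frameMap_frame ht]⟩

/-- The normal forms of the triply even multisets of `35` points. -/
theorem IsTriplyEven35.exists_normal_form {x : V7 → ℤ} (h : IsTriplyEven35 x) :
    ∃ L : V7 ≃ₗ[ZMod 2] V7, (∀ p ≠ 0, x (L p) = excess (frame 0 + frame 1) p) ∨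
      ∀ p ≠ 0, x (L p) = excess (frame 0) p := by
  obtain ⟨D, T, hD, hT, h0T, hsum, hx⟩ := h.exists_decomposition
  obtain ⟨t, htT⟩ : ∃ t : Fin 5 ↪ V7, Finset.univ.map t = T := by
    let e := (T.equivFinOfCardEq hT).symm
    refine ⟨e.toEmbedding.trans (Function.Embedding.subtype _), ?_⟩
    ext q
    simp only [Finset.mem_map, Finset.mem_univ, true_and, Function.Embedding.trans_apply]
    exact ⟨fun ⟨i, hi⟩ => hi ▸ (e i).2, fun hq => ⟨e.symm ⟨q, hq⟩, by simp⟩⟩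
  have ht : ∑ i, t i = 0 := by rw [← hsum, ← htT, Finset.sum_map]
  have hmemT (q : V7) : q ∈ T ↔ q ∈ Set.range t := by rw [← htT]; simp
  have h0 (i : Fin 5) : t i ≠ 0 := fun hi => h0T ((hmemT 0).2 ⟨i, hi⟩)
  have hτ := frameMap_injective ht t.injective h0
  -- A vector orthogonal to both `D` and `T` would have weight 0 in `x`, against the spanning
  -- condition.
  have hsup : D ⊔ LinearMap.range (frameMap t) = ⊤ := by
    by_contra hne
    obtain ⟨v, hv, hort⟩ := exists_orthogonal_of_ne_top hne
    have h8 := h.spanning v hv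
    have : wt x v = 0 := by
      refine Finset.sum_eq_zero fun q _ => ?_
      split_ifs with hq
      · rfl
      · have hqD : q ∉ D := fun hqD => hq (by
          rw [dotProduct_comm]; exact hort q (Submodule.mem_sup_left hqD))
        have hqT : q ∉ T := fun hqT => hq (by
          obtain ⟨i, rfl⟩ := (hmemT q).1 hqT
          rw [dotProduct_comm]
          exact hort _ (Submodule.mem_sup_right ⟨frame i, frameMap_frame ht i⟩))
        have hq0 : q ≠ 0 := fun h => hq (by simp [h])
        simpa [hqT] using (hx q hq0).2 hqD
    omega
  have hone : Module.finrank (ZMod 2) (D ⊓ LinearMap.range (frameMap t) : Submodule _ _) = 1 := by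
    have h1 := Submodule.finrank_sup_add_finrank_inf_eq D (LinearMap.range (frameMap t))
    rw [hsup, finrank_top, LinearMap.finrank_range_of_inj hτ, hD, Module.finrank_fin_fun,
      Module.finrank_fin_fun] at h1
    omega
  obtain ⟨⟨z, hzD, a, rfl⟩, hz0, hz⟩ := finrank_eq_one_iff'.1 hone
  have ha : a ≠ 0 := fun h => hz0 (by simp [h])
  have haD (b : Fin 4 → ZMod 2) : frameMap t b ∈ D ↔ b = 0 ∨ b = a := by
    constructor
    · intro hb
      obtain ⟨c, hc⟩ := hz ⟨frameMap t b, hb, b, rfl⟩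
      have hc' : c • frameMap t a = frameMap t b := congrArg Subtype.val hc
      rcases zmod_two_cases c with rfl | rfl
      · exact Or.inl (hτ (by rw [← hc', zero_smul, map_zero]))
      · exact Or.inr (hτ (by rw [← hc', one_smul]))
    · rintro (rfl | rfl)
      · rw [map_zero]; exact D.zero_mem
      · exact hzD
  -- Reordering the five vectors moves the intersection vector to `frame 0` or `frame 0 + frame 1`.
  have finish (s : Fin 5 → V7) (σ : Equiv.Perm (Fin 5)) (hs : s = t ∘ σ) (a' : Fin 4 → ZMod 2)
      (ha' : frameMap s a' = frameMap t a) :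
      ∃ L : V7 ≃ₗ[ZMod 2] V7, ∀ p ≠ 0, x (L p) = excess a' p := by
    have hs0 : ∑ i, s i = 0 := by rw [hs, ← ht]; exact Equiv.sum_comp σ t
    have hsinj : Function.Injective s := hs ▸ t.injective.comp σ.injective
    have hsne (i : Fin 5) : s i ≠ 0 := by rw [hs]; exact h0 _
    have hsτ := frameMap_injective hs0 hsinj hsne
    have hrange (b : Fin 4 → ZMod 2) : ∃ c, frameMap t c = frameMap s b := by
      by_cases hb : b = 0
      · exact ⟨0, by rw [hb, map_zero, map_zero]⟩
      · rcases frame_cover b hb with ⟨i, rfl⟩ | ⟨i, j, -, rfl⟩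
        · exact ⟨frame (σ i), by rw [frameMap_frame ht, frameMap_frame hs0, hs]; rfl⟩
        · exact ⟨frame (σ i) + frame (σ j), by
            rw [map_add, map_add]; simp only [frameMap_frame ht, frameMap_frame hs0]; rw [hs]; rfl⟩
    obtain ⟨L, hL1, hL2⟩ := exists_normalizing_map hD hs0 hsinj hsne (a := a')
      (fun h => ha (hτ (by rw [← ha', h, map_zero, map_zero]))) (fun b => by
        obtain ⟨c, hc⟩ := hrange b
        rw [← hc, haD, ← hτ.eq_iff, hc, map_zero, ← hτ.eq_iff, hc, ← ha', hsτ.eq_iff,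
          map_eq_zero_iff _ hsτ])
    refine ⟨L, fun p hp => ?_⟩
    have hLp : L p ≠ 0 := fun h => hp (L.map_eq_zero_iff.1 h)
    have hT' : L p ∈ T ↔ tail p = 0 ∧ ∃ i, head p = frame i := by
      rw [hmemT, ← hL2, hs, EquivLike.range_comp]
    unfold excess
    by_cases hpD : L p ∈ D
    · rw [(hx _ hLp).1 hpD, if_pos ((hL1 p).1 hpD)]
      simp only [hT']
    · rw [(hx _ hLp).2 hpD, if_neg (fun h => hpD ((hL1 p).2 h)), zero_add]
      simp only [hT']
  rcases frame_cover a ha with ⟨i, rfl⟩ | ⟨i, j, hij, rfl⟩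
  · have hs0 : ∑ k, t (Equiv.swap 0 i k) = 0 := by
      rw [← ht]; exact Equiv.sum_comp (Equiv.swap 0 i) t
    obtain ⟨L, hL⟩ := finish _ (Equiv.swap 0 i) rfl (frame 0) (by
      rw [frameMap_frame ht]
      refine (frameMap_frame hs0 0).trans ?_
      simp)
    exact ⟨L, Or.inr hL⟩
  · obtain ⟨σ, hσ0, hσ1⟩ := exists_perm_pair i j hij
    have hs0 : ∑ k, t (σ k) = 0 := by rw [← ht]; exact Equiv.sum_comp σ t
    obtain ⟨L, hL⟩ := finish _ σ rfl (frame 0 + frame 1) (by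
      rw [map_add, map_add, frameMap_frame ht, frameMap_frame ht]
      refine (congrArg₂ _ (frameMap_frame hs0 0) (frameMap_frame hs0 1)).trans ?_
      rw [hσ0, hσ1])
    exact ⟨L, Or.inl hL⟩

/-! ### The two tables of lines and their evaluation -/

/-- The vector whose coordinates are the binary digits of `m`. -/
def ofBits (m : ℕ) : V7 := fun i => if m.testBit i then 1 else 0

/-- Generators of the `51` lines of the first code, in binary. -/
def lines₁ : Fin 51 → ℕ × ℕ :=
  ![(1, 94), (2, 20), (5, 56), (6, 121), (7, 113), (9, 71), (10, 71), (11, 68), (13, 50), (13,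
    82), (14, 83), (14, 102), (15, 23), (17, 74), (18, 105), (19, 110), (21, 43), (23, 40), (25,
    97), (26, 67), (27, 47), (27, 111), (28, 47), (29, 35), (29, 44), (30, 39), (30, 99), (31,
    72), (31, 100), (33, 86), (34, 93), (36, 88), (37, 91), (38, 75), (39, 84), (41, 69), (42,
    77), (43, 94), (45, 66), (45, 70), (46, 75), (46, 76), (53, 79), (54, 65), (55, 73), (55,
    92), (58, 87), (59, 81), (59, 85), (60, 78), (61, 90)]

/-- Generators of the `51` lines of the second code, in binary. -/
def lines₂ : Fin 51 → ℕ × ℕ :=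
  ![(1, 14), (3, 77), (5, 43), (7, 19), (7, 74), (9, 22), (11, 35), (11, 84), (13, 21), (13,
    82), (15, 17), (18, 43), (23, 37), (23, 42), (25, 71), (26, 111), (27, 100), (27, 106), (28,
    39), (29, 72), (29, 110), (30, 101), (31, 97), (33, 86), (34, 79), (36, 88), (38, 75), (39,
    94), (41, 69), (44, 67), (45, 70), (45, 91), (46, 83), (47, 68), (47, 81), (49, 87), (51,
    91), (52, 75), (53, 79), (54, 65), (55, 76), (55, 89), (56, 90), (58, 93), (59, 92), (60,
    78), (61, 73), (62, 87), (62, 93), (63, 66), (63, 71)]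

/-- The sum of the seven lowest binary digits. -/
def parity (m : ℕ) : ZMod 2 := ∑ i : Fin 7, if m.testBit i then 1 else 0

lemma ofBits_dotProduct (m n : ℕ) : ofBits m ⬝ᵥ ofBits n = parity (m &&& n) := by
  refine Finset.sum_congr rfl fun i _ => ?_
  simp only [ofBits, Nat.testBit_land, Bool.and_eq_true]
  split_ifs <;> simp_all

lemma bijective_ofBits : Function.Bijective fun m : Fin 128 => ofBits m := by
  have hinj : Function.Injective fun m : Fin 128 => ofBits m := by
    intro m n h
    refine Fin.ext (Nat.eq_of_testBit_eq fun i => ?_)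
    by_cases hi : i < 7
    · have := congrFun h ⟨i, hi⟩
      simp only [ofBits] at this
      split_ifs at this <;> simp_all
    · have h7 : 2 ^ 7 ≤ 2 ^ i := Nat.pow_le_pow_right (by norm_num) (by omega)
      rw [Nat.testBit_lt_two_pow (by omega), Nat.testBit_lt_two_pow (by omega)]
  exact (Fintype.bijective_iff_injective_and_card _).2 ⟨hinj, by rw [card_V7]; rfl⟩

lemma exists_ofBits (p : V7) : ∃ m : Fin 128, ofBits m = p := bijective_ofBits.2 p

/-- The parity of the number of binary digits of a number below `128`, by a lookup table. -/
def oddBits (m : ℕ) : Bool := Nat.testBit 199931532107794273605284333428918544790 m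

lemma parity_eq_iff : ∀ m : Fin 128, ∀ a : ZMod 2, parity m = a ↔ oddBits m = decide (a = 1) := by
  decide +kernel

lemma parity_land_eq_iff (g : ℕ) (m : Fin 128) (a : ZMod 2) :
    parity (g &&& m) = a ↔ oddBits (g &&& m) = decide (a = 1) :=
  parity_eq_iff ⟨g &&& m, Nat.and_lt_two_pow (n := 7) g m.2⟩ a

/-- The number of lines of the table that are not contained in the hyperplane of `p`. -/
def lineWeight (l : Fin 51 → ℕ × ℕ) (p : V7) : ℕ :=
  (Finset.univ.filter fun i => ¬ (ofBits (l i).1 ⬝ᵥ p = 0 ∧ ofBits (l i).2 ⬝ᵥ p = 0)).card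

/-- Recasts the count as bit operations on numerals, which the kernel evaluates quickly. -/
lemma lineWeight_ofBits (l : Fin 51 → ℕ × ℕ) (m : Fin 128) : lineWeight l (ofBits m) =
    (List.ofFn l).countP fun g => oddBits (g.1 &&& m) || oddBits (g.2 &&& m) := by
  rw [List.ofFn_eq_map, List.countP_map, lineWeight, Finset.card_def, Finset.filter_val,
    ← Multiset.countP_eq_card_filter]
  change List.countP _ (List.finRange 51) = _
  refine List.countP_congr fun i _ => ?_
  simp only [ofBits_dotProduct, parity_land_eq_iff]
  cases h₁ : oddBits ((l i).1 &&& m) <;> cases h₂ : oddBits ((l i).2 &&& m) <;> simp [h₁, h₂]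

/-- The normal form `excess` in terms of binary digits. -/
def excessBits (z m : ℕ) : ℤ :=
  (if m % 16 = 0 ∨ m % 16 = z then 1 else 0) +
    4 * if m = 1 ∨ m = 2 ∨ m = 4 ∨ m = 8 ∨ m = 15 then 1 else 0

lemma excess_pair_ofBits :
    ∀ m : Fin 128, excess (frame 0 + frame 1) (ofBits m) = excessBits 3 m := by
  decide +kernel

lemma excess_point_ofBits : ∀ m : Fin 128, excess (frame 0) (ofBits m) = excessBits 1 m := by
  decide +kernel

/-- The factor 2 appears because a line not contained in a hyperplane has two of its three points
outside it. -/
lemma lineWeight_lines₁ (p : V7) (hp : p ≠ 0) :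
    2 * (lineWeight lines₁ p : ℤ) = 76 + 4 * excess (frame 0 + frame 1) p := by
  have key : ∀ m : Fin 128, m ≠ 0 → 2 * (((List.ofFn lines₁).countP fun g =>
      oddBits (g.1 &&& m) || oddBits (g.2 &&& m) : ℕ) : ℤ) = 76 + 4 * excessBits 3 m := by
    decide +kernel
  obtain ⟨m, rfl⟩ := exists_ofBits p
  rw [lineWeight_ofBits, excess_pair_ofBits]
  exact key m fun h => hp (by rw [h]; decide)

lemma lineWeight_lines₂ (p : V7) (hp : p ≠ 0) :
    2 * (lineWeight lines₂ p : ℤ) = 76 + 4 * excess (frame 0) p := by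
  have key : ∀ m : Fin 128, m ≠ 0 → 2 * (((List.ofFn lines₂).countP fun g =>
      oddBits (g.1 &&& m) || oddBits (g.2 &&& m) : ℕ) : ℤ) = 76 + 4 * excessBits 1 m := by
    decide +kernel
  obtain ⟨m, rfl⟩ := exists_ofBits p
  rw [lineWeight_ofBits, excess_point_ofBits]
  exact key m fun h => hp (by rw [h]; decide)

/-- The generators of each line are linearly independent. -/
def IsLineTable (l : Fin 51 → ℕ × ℕ) : Prop :=
  ∀ i, ∀ a b : ZMod 2, ∃ p, ofBits (l i).1 ⬝ᵥ p = a ∧ ofBits (l i).2 ⬝ᵥ p = b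

lemma isLineTable_of_bits {l : Fin 51 → ℕ × ℕ}
    (h : ∀ i, ∀ a b : ZMod 2, ∃ m : Fin 128, oddBits ((l i).1 &&& m) = decide (a = 1) ∧
      oddBits ((l i).2 &&& m) = decide (b = 1)) : IsLineTable l := fun i a b => by
  obtain ⟨m, h1, h2⟩ := h i a b
  exact ⟨ofBits m, by rwa [ofBits_dotProduct, parity_land_eq_iff],
    by rwa [ofBits_dotProduct, parity_land_eq_iff]⟩

lemma isLineTable_lines₁ : IsLineTable lines₁ := isLineTable_of_bits (by decide +kernel)

lemma isLineTable_lines₂ : IsLineTable lines₂ := isLineTable_of_bits (by decide +kernel)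

lemma excess_cases (a : Fin 4 → ZMod 2) (p : V7) :
    excess a p = 0 ∨ excess a p = 1 ∨ excess a p = 4 ∨ excess a p = 5 := by
  unfold excess
  split_ifs <;> simp

/-- In this type `D` contains no element of `T`, so the contributions 1 and 4 never coincide. -/
lemma excess_pair_ne_five (p : V7) : excess (frame 0 + frame 1) p ≠ 5 := by
  obtain ⟨m, rfl⟩ := exists_ofBits p
  rw [excess_pair_ofBits]
  revert m
  decide +kernel

lemma card_filter_ofBits (P : V7 → Prop) [DecidablePred P] :
    (Finset.univ.filter P).card = (Finset.univ.filter fun m : Fin 128 => P (ofBits m)).card :=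
  (Finset.card_bijective _ bijective_ofBits fun m => by simp).symm

lemma card_excess_pair (w : ℤ) :
    (Finset.univ.filter fun p : V7 => p ≠ 0 ∧ excess (frame 0 + frame 1) p = w).card =
      if w = 0 then 107 else if w = 1 then 15 else if w = 4 then 5 else 0 := by
  split_ifs with h1 h2 h3
  · subst h1; simp only [card_filter_ofBits, excess_pair_ofBits]; decide +kernel
  · subst h2; simp only [card_filter_ofBits, excess_pair_ofBits]; decide +kernel
  · subst h3; simp only [card_filter_ofBits, excess_pair_ofBits]; decide +kernel
  · rw [Finset.card_eq_zero, Finset.filter_eq_empty_iff]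
    rintro p - ⟨-, rfl⟩
    have := excess_pair_ne_five p
    rcases excess_cases (frame 0 + frame 1) p with h | h | h | h <;> exact absurd h ‹_›

lemma card_excess_point (w : ℤ) :
    (Finset.univ.filter fun p : V7 => p ≠ 0 ∧ excess (frame 0) p = w).card =
      if w = 0 then 108 else if w = 1 then 14 else if w = 4 then 4 else if w = 5 then 1 else 0 := by
  split_ifs with h1 h2 h3 h4
  · subst h1; simp only [card_filter_ofBits, excess_point_ofBits]; decide +kernel
  · subst h2; simp only [card_filter_ofBits, excess_point_ofBits]; decide +kernel
  · subst h3; simp only [card_filter_ofBits, excess_point_ofBits]; decide +kernel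
  · subst h4; simp only [card_filter_ofBits, excess_point_ofBits]; decide +kernel
  · rw [Finset.card_eq_zero, Finset.filter_eq_empty_iff]
    rintro p - ⟨-, rfl⟩
    rcases excess_cases (frame 0) p with h | h | h | h <;> exact absurd h ‹_›

/-! ### Encoders, columns and isomorphism -/

lemma isomorphic_range {ι κ : Type*} {φ : V7 →ₗ[ZMod 2] ι → ZMod 2} {ψ : V7 →ₗ[ZMod 2] κ → ZMod 2}
    (σ : ι ≃ κ) (h : ∀ p j, ψ p (σ j) = φ p j) :
    Isomorphic (LinearMap.range φ) (LinearMap.range ψ) := by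
  refine ⟨σ, ?_⟩
  rw [← LinearMap.range_comp]
  congr 1
  refine LinearMap.ext fun p => funext fun k => ?_
  have := h p (σ.symm k)
  rw [σ.apply_symm_apply] at this
  rw [this]; rfl

/-- The `j`-th column of the generator matrix of an encoder. -/
def column {ι : Type*} (φ : V7 →ₗ[ZMod 2] ι → ZMod 2) (j : ι) : V7 := fun i => φ (Pi.single i 1) j

lemma dotProduct_column {ι : Type*} (φ : V7 →ₗ[ZMod 2] ι → ZMod 2) (p : V7) (j : ι) :
    p ⬝ᵥ column φ j = φ p j := by
  have h := LinearMap.pi_apply_eq_sum_univ φ p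
  rw [h, Finset.sum_apply]
  refine Finset.sum_congr rfl fun i _ => ?_
  rw [Pi.smul_apply, smul_eq_mul, column]
  congr 1
  refine congrFun (congrArg φ (funext fun k => ?_)) j
  simp [Pi.single_apply, eq_comm]

section Columns

variable {ι κ : Type*} [Fintype ι] [Fintype κ]

/-- The column multiplicities of an encoder. -/
def multiplicity (φ : V7 →ₗ[ZMod 2] ι → ZMod 2) (q : V7) : ℤ :=
  (Finset.univ.filter fun j => column φ j = q).card

lemma multiplicity_nonneg (φ : V7 →ₗ[ZMod 2] ι → ZMod 2) (q : V7) : 0 ≤ multiplicity φ q :=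
  Int.natCast_nonneg _

lemma sum_multiplicity_mul (φ : V7 →ₗ[ZMod 2] ι → ZMod 2) (g : V7 → ℤ) :
    ∑ q, multiplicity φ q * g q = ∑ j, g (column φ j) := by
  have h (q : V7) : multiplicity φ q * g q = ∑ j, if column φ j = q then g q else 0 := by
    rw [← Finset.sum_filter, Finset.sum_const, nsmul_eq_mul]; rfl
  simp only [h]
  rw [Finset.sum_comm]
  simp

lemma walsh_multiplicity_zero (φ : V7 →ₗ[ZMod 2] ι → ZMod 2) :
    walsh (multiplicity φ) 0 = Fintype.card ι := by
  rw [walsh_zero_right]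
  simpa using sum_multiplicity_mul φ 1

lemma wt_multiplicity (φ : V7 →ₗ[ZMod 2] ι → ZMod 2) (p : V7) :
    wt (multiplicity φ) p = hammingNorm (φ p) := by
  have h := sum_multiplicity_mul φ fun q => if p ⬝ᵥ q = 0 then 0 else 1
  simp only [mul_ite, mul_zero, mul_one, dotProduct_column] at h
  rw [wt, h, hammingNorm, Finset.card_filter]
  push_cast
  exact Finset.sum_congr rfl fun j _ => by split_ifs <;> simp_all

/-- Encoders with equal weight functions have isomorphic codes. -/
theorem isomorphic_of_hammingNorm_eq {φ : V7 →ₗ[ZMod 2] ι → ZMod 2}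
    {ψ : V7 →ₗ[ZMod 2] κ → ZMod 2} (hcard : Fintype.card ι = Fintype.card κ)
    (h : ∀ p, hammingNorm (φ p) = hammingNorm (ψ p)) :
    Isomorphic (LinearMap.range φ) (LinearMap.range ψ) := by
  have hm : multiplicity φ = multiplicity ψ := walsh_injective fun p => by
    rw [walsh_eq, walsh_eq (multiplicity ψ), wt_multiplicity, wt_multiplicity,
      walsh_multiplicity_zero, walsh_multiplicity_zero, hcard, h]
  have hq (q : V7) : Nonempty ({j // column φ j = q} ≃ {j // column ψ j = q}) := by
    rw [← Fintype.card_eq, Fintype.card_subtype, Fintype.card_subtype]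
    exact Nat.cast_injective (R := ℤ) (congrFun hm q)
  -- Equal multiplicities allow the coordinates to be matched fibre by fibre over the columns.
  let σ : ι ≃ κ := (Equiv.sigmaFiberEquiv (column φ)).symm.trans
    ((Equiv.sigmaCongrRight fun q => (hq q).some).trans (Equiv.sigmaFiberEquiv (column ψ)))
  have hσ (j : ι) : column ψ (σ j) = column φ j := ((hq (column φ j)).some ⟨j, rfl⟩).2
  refine isomorphic_range σ fun p j => ?_
  rw [← dotProduct_column, ← dotProduct_column, hσ]

lemma weightCount_range {φ : V7 →ₗ[ZMod 2] ι → ZMod 2} (hφ : Function.Injective φ) (w : ℕ) :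
    weightCount (LinearMap.range φ) w =
      (Finset.univ.filter fun p => p ≠ 0 ∧ hammingNorm (φ p) = w).card := by
  have : {c : ι → ZMod 2 | c ∈ LinearMap.range φ ∧ c ≠ 0 ∧ hammingNorm c = w} =
      φ '' (Finset.univ.filter fun p => p ≠ 0 ∧ hammingNorm (φ p) = w : Finset V7) := by
    ext c
    simp only [Set.mem_ofPred_eq, LinearMap.mem_range, Finset.coe_filter, Finset.mem_univ,
      true_and, Set.mem_image]
    constructor
    · rintro ⟨⟨p, rfl⟩, h1, h2⟩
      exact ⟨p, ⟨fun h => h1 (by rw [h, map_zero]), h2⟩, rfl⟩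
    · rintro ⟨p, ⟨h1, h2⟩, rfl⟩
      exact ⟨⟨p, rfl⟩, fun h => h1 (hφ (by rw [h, map_zero])), h2⟩
  rw [weightCount, this, Set.ncard_image_of_injective _ hφ, Set.ncard_coe_finset]

lemma Isomorphic.weightCount_eq {C : BinaryCode ι} {D : BinaryCode κ} (h : Isomorphic C D)
    (w : ℕ) : weightCount C w = weightCount D w := by
  obtain ⟨σ, rfl⟩ := h
  let e := LinearEquiv.funCongrLeft (ZMod 2) (ZMod 2) σ.symm
  have he (c : ι → ZMod 2) : hammingNorm (e c) = hammingNorm c := by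
    refine Finset.card_equiv σ.symm fun k => ?_
    simp only [Finset.mem_filter, Finset.mem_univ, true_and]
    rfl
  rw [weightCount, weightCount, ← Set.ncard_image_of_injective _ e.injective]
  congr 1
  ext d
  simp only [Set.mem_image, Set.mem_ofPred_eq, Submodule.mem_map]
  constructor
  · rintro ⟨c, ⟨h1, h2, h3⟩, rfl⟩
    exact ⟨⟨c, h1, rfl⟩, by simpa using h2, by rw [he, h3]⟩
  · rintro ⟨⟨c, h1, rfl⟩, h2, h3⟩
    exact ⟨c, ⟨h1, fun h => h2 (by rw [h, map_zero]), (he c).symm.trans h3⟩, rfl⟩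

end Columns

/-! ### From admissible codes to multisets of 35 points -/

/-- Every admissible code has, for a suitable encoder, one of two weight functions. -/
theorem IsAdmissible.exists_encoder {C : BinaryCode (Fin 153)} (hC : IsAdmissible C) :
    ∃ φ : V7 →ₗ[ZMod 2] Fin 153 → ZMod 2, LinearMap.range φ = C ∧
      ((∀ p ≠ 0, (hammingNorm (φ p) : ℤ) = 76 + 4 * excess (frame 0 + frame 1) p) ∨
        ∀ p ≠ 0, (hammingNorm (φ p) : ℤ) = 76 + 4 * excess (frame 0) p) := by
  obtain ⟨⟨-, hdim, hdist⟩, hmax⟩ := hC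
  let e : V7 ≃ₗ[ZMod 2] C := LinearEquiv.ofFinrankEq _ _ (by rw [hdim, Module.finrank_fin_fun])
  let φ : V7 →ₗ[ZMod 2] Fin 153 → ZMod 2 := C.subtype ∘ₗ e.toLinearMap
  have hφC (p : V7) : φ p ∈ C := (e p).2
  have hφ : Function.Injective φ := Subtype.val_injective.comp e.injective
  have hrange : LinearMap.range φ = C := by
    rw [LinearMap.range_comp_of_range_eq_top _ e.range, Submodule.range_subtype]
  have hmin (p : V7) (hp : p ≠ 0) : 76 ≤ wt (multiplicity φ) p := by
    rw [wt_multiplicity, ← hammingDist_zero_right]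
    exact_mod_cast hdist _ (hφC p) 0 C.zero_mem fun h => hp (hφ (by rw [h, map_zero]))
  have hle (p : V7) : wt (multiplicity φ) p ≤ 102 := by
    rw [wt_multiplicity]; exact_mod_cast hmax _ (hφC p)
  have hn : walsh (multiplicity φ) 0 = 153 := by rw [walsh_multiplicity_zero]; simp
  have hnn := multiplicity_nonneg φ
  have h4 := four_dvd_wt hnn hn hmin
  have hzero := apply_zero_eq_zero hnn hn hmin
  let x : V7 → ℤ := fun p => if p = 0 then 0 else (wt (multiplicity φ) p - 76) / 4
  have hx (p : V7) (hp : p ≠ 0) : wt (multiplicity φ) p = 76 + 4 * x p := by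
    have := h4 p
    simp only [x, if_neg hp]
    omega
  have hx0 : x 0 = 0 := if_pos rfl
  have hwx (p : V7) : wt (multiplicity φ) p = 76 + 4 * x p - 76 * if p = 0 then 1 else 0 := by
    by_cases hp : p = 0
    · rw [if_pos hp, hp, wt_zero, hx0]; rfl
    · rw [if_neg hp, hx p hp]; ring
  -- Inverting the transform of the weights: 4 W(q) = 76 − 64 f(q) for q ≠ 0. At q = 0 the
  -- corrections give 76 − 76 · 128 + 153 · 64 = 140.
  have hwalsh (q : V7) : 4 * walsh x q = 76 - 64 * multiplicity φ q +
      76 * (if q = 0 then -128 else 0) + 153 * if q = 0 then 64 else 0 := by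
    have h1 : ∑ p, 2 * (chi p q * wt (multiplicity φ) p) =
        153 * (∑ p, chi p q) - 128 * multiplicity φ q := by
      rw [← sum_chi_mul_walsh, Finset.mul_sum, ← Finset.sum_sub_distrib]
      refine Finset.sum_congr rfl fun p _ => ?_
      rw [mul_left_comm, two_mul_wt, hn]; ring
    have h2 : ∑ p, chi p q * wt (multiplicity φ) p =
        76 * (∑ p, chi p q) + 4 * walsh x q - 76 := by
      have (p : V7) : chi p q * wt (multiplicity φ) p =
          76 * chi p q + 4 * (x p * chi q p) - if p = 0 then 76 else 0 := by
        rw [hwx, chi_comm q p]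
        split_ifs with hp
        · subst hp; rw [chi_zero_left]; ring
        · ring
      simp only [this, Finset.sum_sub_distrib, Finset.sum_add_distrib, ← Finset.mul_sum]
      simp [walsh]
    rw [← Finset.mul_sum, h2, sum_chi] at h1
    split_ifs at h1 ⊢ <;> linarith
  have htot : walsh x 0 = 35 := by
    have := hwalsh 0
    rw [hzero] at this
    simp at this
    linarith
  have hwt (q : V7) (hq : q ≠ 0) : wt x q = 8 + 8 * multiplicity φ q := by
    have h1 := hwalsh q
    have h2 := two_mul_wt x q
    simp only [if_neg hq] at h1
    rw [htot] at h2
    linarith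
  have h35 : IsTriplyEven35 x :=
    { nonneg := fun q => by
        by_cases hq : q = 0
        · rw [hq, hx0]
        · have := hx q hq; have := hmin q hq; omega
      le_six := fun q => by
        by_cases hq : q = 0
        · rw [hq, hx0]; norm_num
        -- 76 + 4x ≤ 102 gives x ≤ 6 in integers.
        · have := hx q hq; have := hle q; omega
      zero := hx0
      total := htot
      dvd := fun p => by
        by_cases hp : p = 0
        · rw [hp, wt_zero]; exact dvd_zero _
        · rw [hwt p hp]; exact ⟨1 + multiplicity φ p, by ring⟩
      spanning := fun p hp => by
        have := hwt p hp; have := hnn p; omega }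
  obtain ⟨L, hL⟩ := h35.exists_normal_form
  refine ⟨φ ∘ₗ L.toLinearMap, by rw [LinearMap.range_comp_of_range_eq_top _ L.range, hrange], ?_⟩
  have hLne (p : V7) (hp : p ≠ 0) : L p ≠ 0 := fun h => hp (L.map_eq_zero_iff.1 h)
  refine hL.imp (fun h p hp => ?_) (fun h p hp => ?_)
  · rw [← h p hp, ← hx _ (hLne p hp), wt_multiplicity]; rfl
  · rw [← h p hp, ← hx _ (hLne p hp), wt_multiplicity]; rfl

/-! ### Additive codes over 𝔽₄ from tables of lines -/

lemma finrank_F4 : Module.finrank (ZMod 2) F4 = 2 := GaloisField.finrank 2 (by norm_num)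

/-- Coordinates on `𝔽₄`. -/
noncomputable def coordF4 : F4 ≃ₗ[ZMod 2] (Fin 2 → ZMod 2) :=
  haveI : Module.Finite (ZMod 2) F4 := Module.finite_of_finrank_pos (by rw [finrank_F4]; norm_num)
  LinearEquiv.ofFinrankEq _ _ (by rw [finrank_F4, Module.finrank_fin_fun])

/-- The functionals on `𝔽₄` in coordinates. -/
noncomputable def functionalEquiv : (Fin 2 → ZMod 2) ≃ₗ[ZMod 2] (F4 →ₗ[ZMod 2] ZMod 2) :=
  (Module.piEquiv (Fin 2) (ZMod 2) (ZMod 2)).trans (coordF4.symm.congrLeft (ZMod 2) (ZMod 2))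

lemma functionalEquiv_apply (a : Fin 2 → ZMod 2) (y : F4) :
    functionalEquiv a y = coordF4 y ⬝ᵥ a := by
  simp [functionalEquiv, dotProduct, Module.piEquiv_apply_apply, LinearEquiv.congrLeft]

/-- The nonzero functionals on `𝔽₄` in coordinates. -/
noncomputable def nonzeroFunctionalEquiv : {a : Fin 2 → ZMod 2 // a ≠ 0} ≃ NonzeroFunctional :=
  functionalEquiv.toEquiv.subtypeEquiv fun a => by simp

noncomputable instance : Fintype NonzeroFunctional := Fintype.ofEquiv _ nonzeroFunctionalEquiv

lemma card_nonzeroFunctional : Fintype.card NonzeroFunctional = 3 := by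
  rw [← Fintype.card_congr nonzeroFunctionalEquiv]; decide

/-- A nonzero element of 𝔽₄ is killed by exactly one of the three nonzero functionals; hence binary
weights are twice the 𝔽₄-weights. -/
lemma card_functional_ne_zero [DecidableEq F4] (y : F4) :
    (Finset.univ.filter fun f : NonzeroFunctional => f.1 y ≠ 0).card = if y = 0 then 0 else 2 := by
  have h1 : (Finset.univ.filter fun f : NonzeroFunctional => f.1 y ≠ 0).card =
      (Finset.univ.filter fun a : {a : Fin 2 → ZMod 2 // a ≠ 0} => coordF4 y ⬝ᵥ a.1 ≠ 0).card :=
    (Finset.card_equiv nonzeroFunctionalEquiv fun a => by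
      simp only [Finset.mem_filter, Finset.mem_univ, true_and, ← functionalEquiv_apply]
      rfl).symm
  have h2 : ∀ b : Fin 2 → ZMod 2,
      (Finset.univ.filter fun a : {a : Fin 2 → ZMod 2 // a ≠ 0} => b ⬝ᵥ a.1 ≠ 0).card =
        if b = 0 then 0 else 2 := by decide
  rw [h1, h2]
  simp only [LinearEquiv.map_eq_zero_iff]

/-- The encoder over `𝔽₄` given by a table of lines. -/
noncomputable def encoderF4 (l : Fin 51 → ℕ × ℕ) : V7 →ₗ[ZMod 2] Fin 51 → F4 :=
  LinearMap.pi fun i => coordF4.symm.toLinearMap ∘ₗ LinearMap.pi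
    ![dotProductBilin (ZMod 2) (ZMod 2) (ofBits (l i).1),
      dotProductBilin (ZMod 2) (ZMod 2) (ofBits (l i).2)]

lemma encoderF4_apply (l : Fin 51 → ℕ × ℕ) (p : V7) (i : Fin 51) :
    encoderF4 l p i = coordF4.symm ![ofBits (l i).1 ⬝ᵥ p, ofBits (l i).2 ⬝ᵥ p] := by
  simp only [encoderF4, LinearMap.pi_apply, LinearMap.comp_apply, LinearEquiv.coe_coe]
  congr 1
  funext k
  fin_cases k <;> rfl

lemma encoderF4_eq_zero_iff (l : Fin 51 → ℕ × ℕ) (p : V7) (i : Fin 51) :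
    encoderF4 l p i = 0 ↔ ofBits (l i).1 ⬝ᵥ p = 0 ∧ ofBits (l i).2 ⬝ᵥ p = 0 := by
  rw [encoderF4_apply, LinearEquiv.map_eq_zero_iff, funext_iff, Fin.forall_fin_two]
  rfl

/-- The additive code given by a table of lines. -/
noncomputable def additiveCode (l : Fin 51 → ℕ × ℕ) : AdditiveF4Code 51 :=
  (LinearMap.range (encoderF4 l)).toAddSubgroup

lemma mem_additiveCode {l : Fin 51 → ℕ × ℕ} {c : Fin 51 → F4} :
    c ∈ additiveCode l ↔ ∃ p, encoderF4 l p = c := LinearMap.mem_range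

lemma binaryCode_additiveCode (l : Fin 51 → ℕ × ℕ) :
    (additiveCode l).binaryCode = LinearMap.range (expand 51 ∘ₗ encoderF4 l) := by
  rw [LinearMap.range_comp]; rfl

/-- An enumeration of the `153` points of `51` lines. -/
noncomputable def pointEquiv : Fin 51 × NonzeroFunctional ≃ Fin 153 :=
  Fintype.equivFinOfCardEq (by
    rw [Fintype.card_prod, card_nonzeroFunctional, Fintype.card_fin])

/-- The binary encoder given by a table of lines. -/
noncomputable def encoder (l : Fin 51 → ℕ × ℕ) : V7 →ₗ[ZMod 2] Fin 153 → ZMod 2 :=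
  LinearMap.funLeft (ZMod 2) (ZMod 2) pointEquiv.symm ∘ₗ expand 51 ∘ₗ encoderF4 l

lemma encoder_pointEquiv (l : Fin 51 → ℕ × ℕ) (p : V7) (j : Fin 51 × NonzeroFunctional) :
    encoder l p (pointEquiv j) = j.2.1 (encoderF4 l p j.1) := by
  simp [encoder, expand, LinearMap.funLeft_apply]

lemma hammingNorm_encoderF4 [DecidableEq F4] (l : Fin 51 → ℕ × ℕ) (p : V7) :
    hammingNorm (encoderF4 l p) = lineWeight l p := by
  rw [hammingNorm, lineWeight]
  congr 1
  ext i
  simp only [Finset.mem_filter, ne_eq, encoderF4_eq_zero_iff]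

lemma hammingNorm_encoder (l : Fin 51 → ℕ × ℕ) (p : V7) :
    hammingNorm (encoder l p) = 2 * lineWeight l p := by
  classical
  rw [← hammingNorm_encoderF4]
  have h1 : hammingNorm (encoder l p) =
      (Finset.univ.filter fun j : Fin 51 × NonzeroFunctional =>
        j.2.1 (encoderF4 l p j.1) ≠ 0).card :=
    (Finset.card_equiv pointEquiv fun j => by
      simp only [Finset.mem_filter, Finset.mem_univ, true_and, encoder_pointEquiv]).symm
  rw [h1, Finset.card_filter, Fintype.sum_prod_type]
  simp only [← Finset.card_filter, card_functional_ne_zero]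
  rw [hammingNorm, Finset.card_filter, Finset.mul_sum]
  exact Finset.sum_congr rfl fun i _ => by split_ifs <;> simp_all

/-- A table of lines whose code has minimum weight `76`. -/
structure IsGoodTable (l : Fin 51 → ℕ × ℕ) : Prop where
  isLineTable : IsLineTable l
  le_lineWeight : ∀ p ≠ 0, 38 ≤ lineWeight l p
  lineWeight_le : ∀ p, lineWeight l p ≤ 51
  exists_eq : ∃ p, lineWeight l p = 38

namespace IsGoodTable

variable {l : Fin 51 → ℕ × ℕ}

lemma encoder_injective (h : IsGoodTable l) : Function.Injective (encoder l) := by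
  rw [injective_iff_map_eq_zero]
  intro p hp
  by_contra hne
  have h1 := h.le_lineWeight p hne
  have h2 := hammingNorm_encoder l p
  rw [hp, hammingNorm_zero] at h2
  omega

lemma encoderF4_injective (h : IsGoodTable l) : Function.Injective (encoderF4 l) := by
  have := h.encoder_injective
  rw [encoder, LinearMap.coe_comp, LinearMap.coe_comp] at this
  exact this.of_comp.of_comp

/-- The bound 102 is 2 · 51: at most all 51 lines lie outside a hyperplane. -/
lemma isAdmissible (h : IsGoodTable l) : IsAdmissible (LinearMap.range (encoder l)) := by
  refine ⟨⟨by simp, ?_, ?_⟩, ?_⟩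
  · rw [LinearMap.finrank_range_of_inj h.encoder_injective, Module.finrank_fin_fun]
  · rintro _ ⟨p, rfl⟩ _ ⟨q, rfl⟩ hpq
    rw [hammingDist_eq_hammingNorm, ← map_neg, ← map_add, hammingNorm_encoder]
    have := h.le_lineWeight (-p + q) fun h => hpq (by rw [neg_add_eq_zero.1 h])
    omega
  · rintro _ ⟨p, rfl⟩
    rw [hammingNorm_encoder]
    have := h.lineWeight_le p
    omega

lemma comesFromAdditive (h : IsGoodTable l) :
    ComesFromAdditive (LinearMap.range (encoder l)) 51 38 := by
  classical
  refine ⟨additiveCode l, ?_, ?_, ⟨?_, ?_⟩, ?_⟩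
  · exact (Nat.card_congr (LinearEquiv.ofInjective _ h.encoderF4_injective).toEquiv).symm.trans
      (Nat.card_congr (LinearEquiv.ofInjective _ h.encoder_injective).toEquiv)
  · intro i x
    obtain ⟨p, h1, h2⟩ := h.isLineTable i (coordF4 x 0) (coordF4 x 1)
    refine ⟨encoderF4 l p, mem_additiveCode.2 ⟨p, rfl⟩, ?_⟩
    rw [encoderF4_apply, LinearEquiv.symm_apply_eq, h1, h2]
    funext k
    fin_cases k <;> rfl
  · obtain ⟨p, hp⟩ := h.exists_eq
    refine ⟨encoderF4 l p, mem_additiveCode.2 ⟨p, rfl⟩, 0, zero_mem _, fun h0 => ?_, ?_⟩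
    · have := hammingNorm_encoderF4 l p
      rw [h0, hammingNorm_zero, hp] at this
      omega
    · rw [hammingDist_zero_right]
      convert hammingNorm_encoderF4 l p
      exact hp.symm
  · rintro m ⟨a, ha, b, hb, hab, rfl⟩
    obtain ⟨p, rfl⟩ := mem_additiveCode.1 ha
    obtain ⟨q, rfl⟩ := mem_additiveCode.1 hb
    rw [hammingDist_eq_hammingNorm, ← map_neg, ← map_add]
    refine (h.le_lineWeight (-p + q) fun h => hab (by rw [neg_add_eq_zero.1 h])).trans_eq ?_
    exact (hammingNorm_encoderF4 l _).symm
  · rw [binaryCode_additiveCode]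
    refine isomorphic_range pointEquiv.symm fun p j => ?_
    rfl

end IsGoodTable

lemma isGoodTable_of_excess {l : Fin 51 → ℕ × ℕ} {a : Fin 4 → ZMod 2} (hl : IsLineTable l)
    (h : ∀ p ≠ 0, 2 * (lineWeight l p : ℤ) = 76 + 4 * excess a p)
    (h0 : ∃ p ≠ 0, excess a p = 0) : IsGoodTable l where
  isLineTable := hl
  le_lineWeight p hp := by
    have := h p hp
    rcases excess_cases a p with h | h | h | h <;> omega
  lineWeight_le p := (Finset.card_le_univ _).trans_eq (Fintype.card_fin 51)
  exists_eq := by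
    obtain ⟨p, hp, hp0⟩ := h0
    have := h p hp
    exact ⟨p, by omega⟩

lemma isGoodTable_lines₁ : IsGoodTable lines₁ :=
  -- The message 5 is e₁ + e₃, of excess 0 in both normal forms.
  isGoodTable_of_excess isLineTable_lines₁ lineWeight_lines₁ ⟨ofBits 5, by decide, by decide⟩

lemma isGoodTable_lines₂ : IsGoodTable lines₂ :=
  isGoodTable_of_excess isLineTable_lines₂ lineWeight_lines₂ ⟨ofBits 5, by decide, by decide⟩

/-! ### Weight distributions and conclusion -/

lemma weightCount_encoder {l : Fin 51 → ℕ × ℕ} {a : Fin 4 → ZMod 2} (hl : IsGoodTable l)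
    (h : ∀ p ≠ 0, 2 * (lineWeight l p : ℤ) = 76 + 4 * excess a p) (w : ℕ) :
    weightCount (LinearMap.range (encoder l)) w =
      (Finset.univ.filter fun p => p ≠ 0 ∧ 76 + 4 * excess a p = w).card := by
  rw [weightCount_range hl.encoder_injective]
  congr 1
  refine Finset.filter_congr fun p _ => and_congr_right fun hp => ?_
  rw [hammingNorm_encoder, ← h p hp]
  norm_cast

lemma weightCount_lines₁ (w : ℕ) : weightCount (LinearMap.range (encoder lines₁)) w =
    if w = 76 then 107 else if w = 80 then 15 else if w = 92 then 5 else 0 := by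
  rw [weightCount_encoder isGoodTable_lines₁ lineWeight_lines₁]
  by_cases hw : ∃ v : ℤ, 76 + 4 * v = w
  · obtain ⟨v, hv⟩ := hw
    have h (p : V7) : 76 + 4 * excess (frame 0 + frame 1) p = w ↔
        excess (frame 0 + frame 1) p = v := by omega
    simp only [h, card_excess_pair]
    have e1 : w = 76 ↔ v = 0 := by omega
    have e2 : w = 80 ↔ v = 1 := by omega
    have e3 : w = 92 ↔ v = 4 := by omega
    simp only [e1, e2, e3]
  · rw [Finset.filter_false_of_mem fun p _ hp => hw ⟨_, hp.2⟩, Finset.card_empty,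
      if_neg fun h => hw ⟨0, by rw [h]; rfl⟩, if_neg fun h => hw ⟨1, by rw [h]; rfl⟩,
      if_neg fun h => hw ⟨4, by rw [h]; rfl⟩]

lemma weightCount_lines₂ (w : ℕ) : weightCount (LinearMap.range (encoder lines₂)) w =
    if w = 76 then 108 else if w = 80 then 14 else if w = 92 then 4
      else if w = 96 then 1 else 0 := by
  rw [weightCount_encoder isGoodTable_lines₂ lineWeight_lines₂]
  by_cases hw : ∃ v : ℤ, 76 + 4 * v = w
  · obtain ⟨v, hv⟩ := hw
    have h (p : V7) : 76 + 4 * excess (frame 0) p = w ↔ excess (frame 0) p = v := by omega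
    simp only [h, card_excess_point]
    have e1 : w = 76 ↔ v = 0 := by omega
    have e2 : w = 80 ↔ v = 1 := by omega
    have e3 : w = 92 ↔ v = 4 := by omega
    have e4 : w = 96 ↔ v = 5 := by omega
    simp only [e1, e2, e3, e4]
  · rw [Finset.filter_false_of_mem fun p _ hp => hw ⟨_, hp.2⟩, Finset.card_empty,
      if_neg fun h => hw ⟨0, by rw [h]; rfl⟩, if_neg fun h => hw ⟨1, by rw [h]; rfl⟩,
      if_neg fun h => hw ⟨4, by rw [h]; rfl⟩, if_neg fun h => hw ⟨5, by rw [h]; rfl⟩]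

lemma isomorphic_of_excess {φ : V7 →ₗ[ZMod 2] Fin 153 → ZMod 2} {l : Fin 51 → ℕ × ℕ}
    {a : Fin 4 → ZMod 2} (hφ : ∀ p ≠ 0, (hammingNorm (φ p) : ℤ) = 76 + 4 * excess a p)
    (h : ∀ p ≠ 0, 2 * (lineWeight l p : ℤ) = 76 + 4 * excess a p) :
    Isomorphic (LinearMap.range φ) (LinearMap.range (encoder l)) := by
  refine isomorphic_of_hammingNorm_eq rfl fun p => ?_
  by_cases hp : p = 0
  · rw [hp, map_zero, map_zero]
  · rw [hammingNorm_encoder]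
    exact_mod_cast (hφ p hp).trans (h p hp).symm

end CodeClassification

open CodeClassification in
theorem mainTheorem1 :
    ∃ C₁ C₂ : BinaryCode (Fin 153),
      IsAdmissible C₁ ∧ IsAdmissible C₂ ∧ ¬ Isomorphic C₁ C₂ ∧
      (∀ C : BinaryCode (Fin 153), IsAdmissible C → Isomorphic C C₁ ∨ Isomorphic C C₂) ∧
      (∀ w : ℕ, weightCount C₁ w =
        if w = 76 then 107 else if w = 80 then 15 else if w = 92 then 5 else 0) ∧
      (∀ w : ℕ, weightCount C₂ w =
        if w = 76 then 108 else if w = 80 then 14 else if w = 92 then 4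
          else if w = 96 then 1 else 0) ∧
      ComesFromAdditive C₁ 51 38 ∧ ComesFromAdditive C₂ 51 38 := by
  refine ⟨LinearMap.range (encoder lines₁), LinearMap.range (encoder lines₂),
    isGoodTable_lines₁.isAdmissible, isGoodTable_lines₂.isAdmissible, fun h => ?_, fun C hC => ?_,
    weightCount_lines₁, weightCount_lines₂, isGoodTable_lines₁.comesFromAdditive,
    isGoodTable_lines₂.comesFromAdditive⟩
  -- Only the second code has a word of weight 96.
  · have := h.weightCount_eq 96
    rw [weightCount_lines₁, weightCount_lines₂] at this
    norm_num at this
  · obtain ⟨φ, rfl, hφ⟩ := hC.exists_encoder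
    exact hφ.imp (fun h => isomorphic_of_excess h lineWeight_lines₁)
      (fun h => isomorphic_of_excess h lineWeight_lines₂)
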